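/- Consider $x_{k+1}=A_kx_k+B_ku_k+E_kw_k$, $k=0,\dots,T-1$, with $x_k\in\mathbb R^n$, $u_k\in\mathbb R^m$, $w_k\in\mathbb R^r$, a given initial state $x_0$, and the cost $J(x_0,\mathbf u,\mathbf w)=\sum_{k=0}^{T}(x_k^\top Q_kx_k+u_k^\top R_ku_k)$ with $Q_k\succ0$, $R_k\succ0$. Let $J^*(x_0,\mathbf w)=\min_{\mathbf u}J(x_0,\mathbf u,\mathbf w)$ be the optimal non-causal cost, let $P\succ0$, $\mathcal W=\{w\in\mathbb R^r : w^\top Pw\le1\}$, and $$\mathrm{Regret}^*_{\mathrm{PWB}}=\min_{\mathbf u}\max_{\mathbf w\in\mathcal W^T}\bigl(J(x_0,\mathbf u,\mathbf w)-J^*(x_0,\mathbf w)\bigr),$$ where the minimum is over causal linear time-varying feedbacks $\mathbf u=\mathcal K\mathbf x$ ($\mathcal K$ lower block triangular). Let $\omega$ satisfy $\|\mathbf w\|^2\le\omega$ for all $\mathbf w\in\mathcal W^T$. Put $\mathcal A=\mathrm{blkdiag}(A_0,\dots,A_{T-1},0)$, $\mathcal B=\mathrm{blkdiag}(B_0,\dots,B_{T-1},0)$,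 $\mathcal E=\mathrm{blkdiag}(I,E_0,\dots,E_{T-1})$ (assumed left invertible), $\mathcal Q=\mathrm{blkdiag}(Q_k)$, $\mathcal R=\mathrm{blkdiag}(R_k)$, $C=\mathrm{blkdiag}(\mathcal Q,\mathcal R)$, and let $\mathcal Z$ be the block downshift. Put $F=(I-\mathcal Z\mathcal A)^{-1}\mathcal Z\mathcal B$, $G=(I-\mathcal Z\mathcal A)^{-1}\mathcal E$ and $O=G^\top(\mathcal Q^{-1}+F\mathcal R^{-1}F^\top)^{-1}G=\begin{bmatrix}O_1&O_2^\top\\O_2&O_3\end{bmatrix}$, partitioned according to $(x_0,\mathbf w)$. Let $\mathcal P_i$ ($1\le i\le T$) be the block matrix with $P$ at block $(i,i)$ and zeros elsewhere. A response is a matrix $\Phi=\begin{bmatrix}\Phi_x\\\Phi_u\end{bmatrix}=[\Phi^0\ \ \Phi^w]$ with $\Phi_x,\Phi_u$ lower block triangular and $[I-\mathcal Z\mathcal A\ \ -\mathcal Z\mathcal B]\,\Phi=\mathcal E$. For a number $a$ and a matrix $N$ put $$M(a,N,\Phi)=\begin{bmatrix}x_0^\top O_1x_0+a&x_0^\top O_2^\top&x_0^\top\Phi^{0\top}\\O_2x_0&O_3+N&\Phi^{w\top}\\\Phi^0x_0&\Phi^w&C^{-1}\end{bmatrix}.$$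 Let $\bar\gamma^*$ be the minimum of $\sum_{i=0}^T\bar\lambda_i$ over responses $\bar\Phi$ and $\bar\lambda_0,\dots,\bar\lambda_T\ge0$ with $M\bigl(\bar\lambda_T,\sum_{i=0}^{T-1}\bar\lambda_i\mathcal P_{i+1},\bar\Phi\bigr)\succeq0$, and let $\gamma^*$ be the minimum of $\gamma$ over responses $\Phi$, $\gamma\in\mathbb R$ and $\lambda\ge0$ with $M(\gamma-\lambda\omega,\lambda I,\Phi)\succeq0$. Then the matrix inequality defining $\bar\gamma^*$ is affine in $(\bar\Phi,\bar\lambda)$, all these minima and maxima are attained, and $$\frac2\pi\,\bar\gamma^*\le\mathrm{Regret}^*_{\mathrm{PWB}}\le\bar\gamma^*\le\gamma^*.$$ Moreover, for every optimal $(\bar\Phi,\bar\lambda)$ of the first program, $\bar\Phi_x$ has a left inverse $L$ (which is $\bar\Phi_x^{-1}$ if $r=n$) for which $\mathcal K=\bar\Phi_uL$ is causal; and every causal $\mathcal K$ with $\mathcal K\bar\Phi_x=\bar\Phi_u$, in particular this one, gives a feedback $\mathbf u=\mathcal K\mathbf x$ whose worst-case regret over $\mathcal W^T$ lies between $\mathrm{Regret}^*_{\mathrm{PWB}}$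 and $\bar\gamma^*$. -/

import Mathlib

open scoped Matrix

noncomputable section

namespace RegretControl

/-- Index set of the stacked states `x_0, …, x_T` in `ℝⁿ` (also used for stacked inputs):
the entry `(i, k)` is the `i`-th component at time `k`. -/
abbrev Stk (n T : ℕ) : Type := Fin n × Fin (T + 1)

/-- Index set of the stacked disturbances `w_0, …, w_{T-1}` in `ℝʳ`. -/
abbrev Dst (r T : ℕ) : Type := Fin r × Fin T

/-- Index set of `δ = (x_0, w)`. -/
abbrev Dlt (n r T : ℕ) : Type := Fin n ⊕ Dst r T

/-- The block position of an entry of `δ`: `0` for `x_0`, and `k + 1` for `w_k`. -/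
def Dlt.block {n r T : ℕ} : Dlt n r T → Fin (T + 1)
  | Sum.inl _ => 0
  | Sum.inr p => p.2.succ

/-- A finite-horizon linear time-varying system `x_{k+1} = A_k x_k + B_k u_k + E_k w_k`,
with its initial state and the weights of the stage costs `xᵀ Q_k x + uᵀ R_k u`. -/
structure Plant (n m r T : ℕ) where
  /-- state matrices -/
  A : Fin T → Matrix (Fin n) (Fin n) ℝ
  /-- input matrices -/
  B : Fin T → Matrix (Fin n) (Fin m) ℝ
  /-- disturbance matrices -/
  E : Fin T → Matrix (Fin n) (Fin r) ℝ
  /-- state weights -/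
  Q : Fin (T + 1) → Matrix (Fin n) (Fin n) ℝ
  /-- input weights -/
  R : Fin (T + 1) → Matrix (Fin m) (Fin m) ℝ
  /-- initial state -/
  x0 : Fin n → ℝ

/-- The product `W^T` of the ellipsoids `{w | wᵀ P w ≤ 1}`. -/
def ellipsoids {r : ℕ} (T : ℕ) (P : Matrix (Fin r) (Fin r) ℝ) : Set (Fin T → Fin r → ℝ) :=
  {w | ∀ k, w k ⬝ᵥ (P *ᵥ w k) ≤ 1}

/-- Stacking a sequence of vectors into one vector. -/
def stack {n T : ℕ} (x : Fin (T + 1) → Fin n → ℝ) : Stk n T → ℝ := fun p => x p.2 p.1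

/-- A linear time-varying state feedback `u = K x` is causal if `u_k` depends on `x_0, …, x_k`
only, i.e. if `K` is lower block triangular. -/
def CausalGain {n m T : ℕ} (K : Matrix (Stk m T) (Stk n T) ℝ) : Prop :=
  ∀ p q, p.2 < q.2 → K p q = 0

/-- A map from `δ` to a stacked sequence is causal if its matrix is lower block triangular. -/
def CausalMap {n r d T : ℕ} (M : Matrix (Stk d T) (Dlt n r T) ℝ) : Prop :=
  ∀ p q, p.2 < Dlt.block q → M p q = 0

/-- The block-downshift operator, with identities on the first block subdiagonal. -/
def shift (n T : ℕ) : Matrix (Stk n T) (Stk n T) ℝ :=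
  Matrix.of fun p q => if p.1 = q.1 ∧ (p.2 : ℕ) = (q.2 : ℕ) + 1 then 1 else 0

/-- The block diagonal matrix with `P` at block position `(i, i)` and zeros elsewhere. -/
def blockP {r T : ℕ} (P : Matrix (Fin r) (Fin r) ℝ) (i : Fin T) :
    Matrix (Dst r T) (Dst r T) ℝ :=
  Matrix.blockDiagonal (Pi.single i P)

namespace Plant

variable {n m r T : ℕ} (S : Plant n m r T)

/-! ### Trajectories, costs and regret -/

/-- The state sequence generated by the inputs `u` and the disturbances `w`. -/
def state (u : Fin (T + 1) → Fin m → ℝ) (w : Fin T → Fin r → ℝ) : Fin (T + 1) → Fin n → ℝ :=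
  fun k => Fin.induction (motive := fun _ => Fin n → ℝ) S.x0
    (fun k x => S.A k *ᵥ x + S.B k *ᵥ u k.castSucc + S.E k *ᵥ w k) k

/-- The incurred cost `J(x_0, u, w)`. -/
def cost (u : Fin (T + 1) → Fin m → ℝ) (w : Fin T → Fin r → ℝ) : ℝ :=
  ∑ k, (S.state u w k ⬝ᵥ (S.Q k *ᵥ S.state u w k) + u k ⬝ᵥ (S.R k *ᵥ u k))

/-- The optimal non-causal cost `J*(x_0, w)`: the input sequence is chosen knowing all of `w`
(costs are nonnegative for positive definite weights, so the infimum is the true one). -/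
def optCost (w : Fin T → Fin r → ℝ) : ℝ := ⨅ u : Fin (T + 1) → Fin m → ℝ, S.cost u w

/-- `u` is the input sequence that the feedback `u = K x` generates under the disturbances `w`. -/
def ClosedLoop (K : Matrix (Stk m T) (Stk n T) ℝ) (u : Fin (T + 1) → Fin m → ℝ)
    (w : Fin T → Fin r → ℝ) : Prop :=
  stack u = K *ᵥ stack (S.state u w)

/-- `ρ` is the worst-case dynamic regret of the feedback `u = K x` over disturbances in `W`. -/
def IsWorstRegret (W : Set (Fin T → Fin r → ℝ)) (K : Matrix (Stk m T) (Stk n T) ℝ) (ρ : ℝ) :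
    Prop :=
  IsGreatest {g | ∃ w ∈ W, ∃ u, S.ClosedLoop K u w ∧ g = S.cost u w - S.optCost w} ρ

/-- `ρ` is the optimal dynamic regret over disturbances in `W`: the minimum of the worst-case
regret over all causal linear time-varying feedback controllers. -/
def IsOptRegret (W : Set (Fin T → Fin r → ℝ)) (ρ : ℝ) : Prop :=
  IsLeast {g | ∃ K, CausalGain K ∧ S.IsWorstRegret W K g} ρ

/-! ### Stacked matrices -/

/-- `blkdiag(A_0, …, A_{T-1}, 0)` -/
def calA : Matrix (Stk n T) (Stk n T) ℝ :=
  Matrix.blockDiagonal (Fin.snoc (α := fun _ => Matrix (Fin n) (Fin n) ℝ) S.A 0)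

/-- `blkdiag(B_0, …, B_{T-1}, 0)` -/
def calB : Matrix (Stk n T) (Stk m T) ℝ :=
  Matrix.blockDiagonal (Fin.snoc (α := fun _ => Matrix (Fin n) (Fin m) ℝ) S.B 0)

/-- `blkdiag(I, E_0, …, E_{T-1})` -/
def calE : Matrix (Stk n T) (Dlt n r T) ℝ :=
  Matrix.of fun p q => match q with
    | Sum.inl j => if p.2 = 0 ∧ p.1 = j then 1 else 0
    | Sum.inr (j, l) => if p.2 = l.succ then S.E l p.1 j else 0

/-- `blkdiag(Q_0, …, Q_T)` -/
def calQ : Matrix (Stk n T) (Stk n T) ℝ := Matrix.blockDiagonal S.Q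

/-- `blkdiag(R_0, …, R_T)` -/
def calR : Matrix (Stk m T) (Stk m T) ℝ := Matrix.blockDiagonal S.R

/-- `C = blkdiag(𝒬, ℛ)` -/
def calC : Matrix (Stk n T ⊕ Stk m T) (Stk n T ⊕ Stk m T) ℝ :=
  Matrix.fromBlocks S.calQ 0 0 S.calR

/-- The matrix `F` in `x = F u + G δ`. -/
def calF : Matrix (Stk n T) (Stk m T) ℝ := (1 - shift n T * S.calA)⁻¹ * (shift n T * S.calB)

/-- The matrix `G` in `x = F u + G δ`. -/
def calG : Matrix (Stk n T) (Dlt n r T) ℝ := (1 - shift n T * S.calA)⁻¹ * S.calE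

/-- The matrix `O = Gᵀ (𝒬⁻¹ + F ℛ⁻¹ Fᵀ)⁻¹ G` of the optimal non-causal cost. -/
def calO : Matrix (Dlt n r T) (Dlt n r T) ℝ :=
  S.calGᵀ * (S.calQ⁻¹ + S.calF * S.calR⁻¹ * S.calFᵀ)⁻¹ * S.calG

/-! ### The two semidefinite programs -/

/-- `Φ` (with row blocks `Φ_x`, `Φ_u`) is a causal system response:
`[I - 𝒵𝒜, -𝒵ℬ] Φ = ℰ`, with `Φ_x` and `Φ_u` lower block triangular. -/
def IsResponse (Φ : Matrix (Stk n T ⊕ Stk m T) (Dlt n r T) ℝ) : Prop :=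
  CausalMap Φ.toRows₁ ∧ CausalMap Φ.toRows₂ ∧
    Matrix.fromCols (1 - shift n T * S.calA) (-(shift n T * S.calB)) * Φ = S.calE

/-- The symmetric matrix
`[[x₀ᵀ O₁ x₀ + a, x₀ᵀ O₂ᵀ, x₀ᵀ Φ⁰ᵀ], [O₂ x₀, O₃ + N, Φʷᵀ], [Φ⁰ x₀, Φʷ, C⁻¹]]`. -/
def lmi (a : ℝ) (N : Matrix (Dst r T) (Dst r T) ℝ)
    (Φ : Matrix (Stk n T ⊕ Stk m T) (Dlt n r T) ℝ) :
    Matrix (Unit ⊕ (Dst r T ⊕ (Stk n T ⊕ Stk m T))) (Unit ⊕ (Dst r T ⊕ (Stk n T ⊕ Stk m T))) ℝ :=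
  Matrix.fromBlocks
    (Matrix.of fun _ _ => S.x0 ⬝ᵥ (S.calO.toBlocks₁₁ *ᵥ S.x0) + a)
    (Matrix.replicateRow Unit (Sum.elim (S.calO.toBlocks₂₁ *ᵥ S.x0) (Φ.toCols₁ *ᵥ S.x0)))
    (Matrix.replicateCol Unit (Sum.elim (S.calO.toBlocks₂₁ *ᵥ S.x0) (Φ.toCols₁ *ᵥ S.x0)))
    (Matrix.fromBlocks (S.calO.toBlocks₂₂ + N) Φ.toCols₂ᵀ Φ.toCols₂ S.calC⁻¹)

/-- The matrix of the linear matrix inequality for pointwise bounded disturbances. -/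
def lmiPWB (P : Matrix (Fin r) (Fin r) ℝ) (Φ : Matrix (Stk n T ⊕ Stk m T) (Dlt n r T) ℝ)
    (lam : Fin (T + 1) → ℝ) :
    Matrix (Unit ⊕ (Dst r T ⊕ (Stk n T ⊕ Stk m T))) (Unit ⊕ (Dst r T ⊕ (Stk n T ⊕ Stk m T))) ℝ :=
  S.lmi (lam (Fin.last T)) (∑ i : Fin T, lam i.castSucc • blockP P i) Φ

/-- Feasible points of the program for pointwise bounded disturbances. -/
def FeasiblePWB (P : Matrix (Fin r) (Fin r) ℝ)
    (Φ : Matrix (Stk n T ⊕ Stk m T) (Dlt n r T) ℝ) (lam : Fin (T + 1) → ℝ) : Prop :=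
  (∀ i, 0 ≤ lam i) ∧ S.IsResponse Φ ∧ (S.lmiPWB P Φ lam).PosSemidef

/-- `γ` is the optimal value of the program for pointwise bounded disturbances. -/
def IsValuePWB (P : Matrix (Fin r) (Fin r) ℝ) (γ : ℝ) : Prop :=
  IsLeast {g | ∃ Φ lam, S.FeasiblePWB P Φ lam ∧ g = ∑ i, lam i} γ

/-- Feasible points of the program for disturbances of energy at most `ω`. -/
def FeasibleEnergy (ω : ℝ) (Φ : Matrix (Stk n T ⊕ Stk m T) (Dlt n r T) ℝ) (γ lam : ℝ) : Prop :=
  0 ≤ lam ∧ S.IsResponse Φ ∧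
    (S.lmi (-(lam * ω) + γ) (lam • (1 : Matrix (Dst r T) (Dst r T) ℝ)) Φ).PosSemidef

/-- `γ` is the optimal value of the program for disturbances of energy at most `ω`. -/
def IsValueEnergy (ω γ : ℝ) : Prop :=
  IsLeast {g | ∃ Φ lam, S.FeasibleEnergy ω Φ g lam} γ

end Plant

end RegretControl

end

noncomputable section

namespace RegretControl

/-! ### Gaussian rounding -/

section Gaussian

open MeasureTheory ProbabilityTheory

open scoped RealInnerProductSpace

/-! Along a fixed response `Φ` the regret is a quadratic form. Scaling the initial state to `t x₀`
makes it homogeneous in `(t, w)`, with matrix `regretForm (Φ * lift)`; this matrix is positive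
semidefinite because no input beats the non-causal optimum, whose value is the quadratic form of
`calO` (`optCost_eq`). Eliminating the block `C⁻¹` by a Schur complement turns the matrix inequality
into domination of this form by `a t² + wᵀ N w` (`posSemidef_lmi_iff`).

Feasible multipliers therefore bound the regret on the product of ellipsoids by their sum.
Conversely, let `v` bound the regret of a response on that product. Symmetry and convexity extend
the bound to `t² ≤ 1`, and a linear change of variables turns the ellipsoids into unit balls. By
`exists_multipliers`, multipliers of sum at most `π / 2 * v` then certify the bound. That lemma
separates a point from the convex set of values and block traces of the semidefinite relaxation;
Gaussian rounding (`exists_rounding`) shows that the relaxation overestimates a positive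
semidefinite form by a factor of at most `π / 2`.

An energy certificate becomes a pointwise one because `‖w_k‖² ≤ μ w_kᵀ P w_k`, where `μ` is the
largest squared norm on the ellipsoid and `T μ ≤ ω`.

Responses and causal feedbacks correspond: a feedback defines its closed-loop response, and a
response is factored by a causal feedback since `ℰ` is left invertible
(`IsResponse.exists_leftInverse`). For attainment, only `Φ * lift` matters, since `Φ⁰` enters
through `Φ⁰ x₀` alone. These products form a closed affine space on which bounded regret forces
bounded entries. -/

theorem integral_abs_gaussianReal : ∫ x, |x| ∂(gaussianReal 0 1) = Real.sqrt (2 / Real.pi) := by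
  rw [integral_gaussianReal_eq_integral_smul (by norm_num)]
  have h : ∀ x : ℝ, gaussianPDFReal 0 1 x • |x| =
      (Real.sqrt (2 * Real.pi))⁻¹ * (fun y : ℝ => y * Real.exp (-(1 / 2) * y ^ 2)) |x| := by
    intro x
    simp only [gaussianPDFReal, smul_eq_mul, sq_abs, NNReal.coe_one, mul_one, sub_zero]
    ring_nf
  simp_rw [h]
  rw [integral_const_mul, integral_comp_abs (f := fun y : ℝ => y * Real.exp (-(1 / 2) * y ^ 2))]
  have h2 := integral_mul_cexp_neg_mul_sq (b := 1 / 2) (by norm_num)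
  have h3 : ∫ r : ℝ in Set.Ioi 0, r * Real.exp (-(1 / 2) * r ^ 2) = 1 := by
    have : ((∫ r : ℝ in Set.Ioi 0, r * Real.exp (-(1 / 2) * r ^ 2) : ℝ) : ℂ) = 1 := by
      rw [← integral_complex_ofReal]
      push_cast
      rw [h2]; norm_num
    exact_mod_cast this
  rw [h3]
  rw [Real.sqrt_div (by norm_num), Real.sqrt_mul (by norm_num)]
  have : Real.sqrt 2 * Real.sqrt 2 = 2 := Real.mul_self_sqrt (by norm_num)
  have hp : Real.sqrt Real.pi ≠ 0 := by positivity
  field_simp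
  nlinarith

theorem integral_sum_mul {ι Ω : Type*} [Fintype ι] [MeasurableSpace Ω] (μ : Measure Ω) (H : Matrix ι ι ℝ)
    (f : ι → ι → Ω → ℝ) (hf : ∀ i j, Integrable (f i j) μ) :
    Integrable (fun x => ∑ i, ∑ j, H i j * f i j x) μ ∧
      ∫ x, ∑ i, ∑ j, H i j * f i j x ∂μ = ∑ i, ∑ j, H i j * ∫ x, f i j x ∂μ := by
  have h1 : ∀ i j, Integrable (fun x => H i j * f i j x) μ := fun i j => (hf i j).const_mul _
  have h2 : ∀ i, Integrable (fun x => ∑ j, H i j * f i j x) μ := fun i =>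
    integrable_finsetSum _ fun j _ => h1 i j
  refine ⟨integrable_finsetSum _ fun i _ => h2 i, ?_⟩
  rw [integral_finsetSum _ fun i _ => h2 i]
  refine Finset.sum_congr rfl fun i _ => ?_
  rw [integral_finsetSum _ fun j _ => h1 i j]
  exact Finset.sum_congr rfl fun j _ => integral_const_mul _ _

variable {E : Type*} [NormedAddCommGroup E] [InnerProductSpace ℝ E]

/-- The sign of the projection of `x` on `b`, scaled by the length of `b`. -/
def roundedInner (b x : E) : ℝ := ‖b‖ * (SignType.sign ⟪b, x⟫ : ℝ)

theorem abs_roundedInner_le (b x : E) : |roundedInner b x| ≤ ‖b‖ := by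
  unfold roundedInner
  rw [abs_mul, abs_norm]
  refine mul_le_of_le_one_right (norm_nonneg _) ?_
  cases SignType.sign ⟪b, x⟫ <;> simp

variable [FiniteDimensional ℝ E] [MeasurableSpace E] [BorelSpace E]

theorem integrable_inner_stdGaussian (a : E) : Integrable (fun x => ⟪a, x⟫) (stdGaussian E) :=
  IsGaussian.integrable_dual (stdGaussian E) (innerSL ℝ a)

theorem memLp_inner_stdGaussian (a : E) : MemLp (fun x => ⟪a, x⟫) 2 (stdGaussian E) :=
  IsGaussian.memLp_dual (stdGaussian E) (innerSL ℝ a) 2 (by norm_num)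

theorem integrable_inner_mul_inner_stdGaussian (a b : E) :
    Integrable (fun x => ⟪a, x⟫ * ⟪b, x⟫) (stdGaussian E) :=
  (memLp_inner_stdGaussian a).integrable_mul (memLp_inner_stdGaussian b)

theorem integral_inner_mul_inner_stdGaussian (a b : E) :
    ∫ x, ⟪a, x⟫ * ⟪b, x⟫ ∂(stdGaussian E) = ⟪a, b⟫ := by
  have h := covarianceBilin_apply (μ := stdGaussian E) IsGaussian.memLp_two_id a b
  rw [covarianceBilin_stdGaussian, innerSL_apply_apply] at h
  rw [h]
  simp [integral_id_stdGaussian]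

theorem integral_abs_inner_stdGaussian (b : E) :
    ∫ x, |⟪b, x⟫| ∂(stdGaussian E) = ‖b‖ * Real.sqrt (2 / Real.pi) := by
  have h := IsGaussian.map_eq_gaussianReal (μ := stdGaussian E) (innerSL ℝ b)
  rw [integral_strongDual_stdGaussian, variance_dual_stdGaussian, innerSL_apply_norm] at h
  have h1 : ∫ x, |⟪b, x⟫| ∂(stdGaussian E) = ∫ y, |y| ∂((stdGaussian E).map (innerSL ℝ b)) := by
    rw [integral_map (by fun_prop) (by fun_prop)]
    rfl
  have h2 : gaussianReal 0 (‖b‖ ^ 2).toNNReal = (gaussianReal 0 1).map (‖b‖ * ·) := by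
    rw [gaussianReal_map_const_mul, mul_zero, mul_one]
    congr 1
    ext
    simp
  rw [h1, h, h2, integral_map (by fun_prop) (by fun_prop)]
  simp_rw [abs_mul, abs_norm]
  rw [integral_const_mul, integral_abs_gaussianReal]

theorem measurable_roundedInner (b : E) : Measurable (roundedInner b) := by
  unfold roundedInner
  have h : Measurable fun y : ℝ => ((SignType.sign y : SignType) : ℝ) := by
    have : (fun y : ℝ => ((SignType.sign y : SignType) : ℝ)) =
        fun y => if 0 < y then 1 else if y < 0 then -1 else 0 := by
      funext y
      rw [sign_apply]
      split_ifs <;> simp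
    rw [this]
    exact Measurable.ite measurableSet_Ioi measurable_const
      (Measurable.ite measurableSet_Iio measurable_const measurable_const)
  exact (h.comp (by fun_prop : Measurable fun x : E => ⟪b, x⟫)).const_mul _

theorem integrable_inner_mul_roundedInner (a b : E) :
    Integrable (fun x => ⟪a, x⟫ * roundedInner b x) (stdGaussian E) :=
  (integrable_inner_stdGaussian a).mul_bdd (c := ‖b‖) (measurable_roundedInner b).aestronglyMeasurable
    (.of_forall fun x => abs_roundedInner_le b x)

theorem integrable_roundedInner_mul_roundedInner (a b : E) :
    Integrable (fun x => roundedInner a x * roundedInner b x) (stdGaussian E) := by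
  refine Integrable.mul_bdd (c := ‖b‖) ?_ (measurable_roundedInner b).aestronglyMeasurable
    (.of_forall fun x => abs_roundedInner_le b x)
  exact Integrable.of_bound (measurable_roundedInner a).aestronglyMeasurable ‖a‖
    (.of_forall fun x => abs_roundedInner_le a x)

/-- The reflection in the line spanned by `b` preserves the Gaussian and fixes `⟪b, x⟫`, hence the
rounded value. Averaging over it replaces `a` by its projection on `b`, which leaves only the mean
of `|⟪b, x⟫|`. -/
theorem integral_inner_mul_roundedInner (a b : E) :
    ∫ x, ⟪a, x⟫ * roundedInner b x ∂(stdGaussian E) = Real.sqrt (2 / Real.pi) * ⟪a, b⟫ := by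
  rcases eq_or_ne b 0 with rfl | hb
  · simp [roundedInner]
  have hb' : ‖b‖ ≠ 0 := norm_ne_zero_iff.mpr hb
  set R : E ≃ₗᵢ[ℝ] E := Submodule.reflection (Submodule.span ℝ {b}) with hR
  have hRx : ∀ x, R x = (2 * (⟪b, x⟫ / ‖b‖ ^ 2)) • b - x := by
    intro x
    rw [hR, Submodule.reflection_singleton_apply, two_smul, two_mul, add_smul]
    rfl
  have hbR : ∀ x, ⟪b, R x⟫ = ⟪b, x⟫ := by
    intro x
    rw [hRx, inner_sub_right, inner_smul_right, real_inner_self_eq_norm_sq]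
    field_simp; ring
  have haR : ∀ x, ⟪a, R x⟫ = (2 * ⟪a, b⟫ / ‖b‖ ^ 2) * ⟪b, x⟫ - ⟪a, x⟫ := by
    intro x
    rw [hRx, inner_sub_right, inner_smul_right]
    ring
  have hround : ∀ x, roundedInner b (R x) = roundedInner b x := by
    intro x; unfold roundedInner; rw [hbR]
  have habs : ∀ x, ⟪b, x⟫ * roundedInner b x = ‖b‖ * |⟪b, x⟫| := by
    intro x; unfold roundedInner
    rcases lt_trichotomy ⟪b, x⟫ 0 with h | h | h
    · simp [h, abs_of_neg, mul_comm]
    · simp [h]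
    · simp [h, abs_of_pos, mul_comm]
  have h1 : ∫ x, ⟪a, x⟫ * roundedInner b x ∂(stdGaussian E) =
      ∫ x, ⟪a, R x⟫ * roundedInner b (R x) ∂(stdGaussian E) := by
    conv_lhs => rw [← stdGaussian_map R]
    rw [integral_map (by fun_prop)]
    exact ((by fun_prop : Measurable fun x : E => ⟪a, x⟫).mul
      (measurable_roundedInner b)).aestronglyMeasurable
  have h2 : ∫ x, ⟪a, R x⟫ * roundedInner b (R x) ∂(stdGaussian E) =
      (2 * ⟪a, b⟫ / ‖b‖ ^ 2) * (‖b‖ * (‖b‖ * Real.sqrt (2 / Real.pi))) -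
        ∫ x, ⟪a, x⟫ * roundedInner b x ∂(stdGaussian E) := by
    have : ∀ x, ⟪a, R x⟫ * roundedInner b (R x) =
        (2 * ⟪a, b⟫ / ‖b‖ ^ 2) * (⟪b, x⟫ * roundedInner b x) - ⟪a, x⟫ * roundedInner b x := by
      intro x; rw [haR, hround]; ring
    simp_rw [this]
    rw [integral_sub ((integrable_inner_mul_roundedInner b b).const_mul _)
      (integrable_inner_mul_roundedInner a b), integral_const_mul]
    simp_rw [habs]
    rw [integral_const_mul, integral_abs_inner_stdGaussian]
  have h3 : (2 * ⟪a, b⟫ / ‖b‖ ^ 2) * (‖b‖ * (‖b‖ * Real.sqrt (2 / Real.pi))) =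
      2 * (Real.sqrt (2 / Real.pi) * ⟪a, b⟫) := by
    field_simp
  linarith

/-- The factor `√(2 / π)` makes the cross terms combine with the square of the inner products into
`-2 / π * ⟪a, b⟫`. Residuals thus measure how far rounding stays above `2 / π` times the Gram
matrix, without the arcsine formula. -/
theorem integral_residual_mul_residual (a b : E) :
    Integrable (fun x => (Real.sqrt (2 / Real.pi) * ⟪a, x⟫ - roundedInner a x) *
        (Real.sqrt (2 / Real.pi) * ⟪b, x⟫ - roundedInner b x)) (stdGaussian E) ∧
      ∫ x, (Real.sqrt (2 / Real.pi) * ⟪a, x⟫ - roundedInner a x) *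
        (Real.sqrt (2 / Real.pi) * ⟪b, x⟫ - roundedInner b x) ∂(stdGaussian E) =
        ∫ x, roundedInner a x * roundedInner b x ∂(stdGaussian E) - 2 / Real.pi * ⟪a, b⟫ := by
  set k := Real.sqrt (2 / Real.pi) with hk
  have hk2 : k * k = 2 / Real.pi := Real.mul_self_sqrt (by positivity)
  have e : ∀ x, (k * ⟪a, x⟫ - roundedInner a x) * (k * ⟪b, x⟫ - roundedInner b x) =
      (k * k) * (⟪a, x⟫ * ⟪b, x⟫) - k * (⟪a, x⟫ * roundedInner b x)
        - k * (⟪b, x⟫ * roundedInner a x) + roundedInner a x * roundedInner b x :=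
    fun x => by ring
  simp_rw [e]
  have i1 := (integrable_inner_mul_inner_stdGaussian a b).const_mul (k * k)
  have i2 := (integrable_inner_mul_roundedInner a b).const_mul k
  have i3 := (integrable_inner_mul_roundedInner b a).const_mul k
  have i4 := integrable_roundedInner_mul_roundedInner a b
  have i12 : Integrable (fun x => (k * k) * (⟪a, x⟫ * ⟪b, x⟫) - k * (⟪a, x⟫ * roundedInner b x))
    (stdGaussian E) := i1.sub i2
  have i123 : Integrable (fun x => (k * k) * (⟪a, x⟫ * ⟪b, x⟫) - k * (⟪a, x⟫ * roundedInner b x)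
    - k * (⟪b, x⟫ * roundedInner a x)) (stdGaussian E) := i12.sub i3
  refine ⟨i123.add i4, ?_⟩
  rw [integral_add i123 i4, integral_sub i12 i3, integral_sub i1 i2,
    integral_const_mul, integral_const_mul, integral_const_mul,
    integral_inner_mul_inner_stdGaussian, integral_inner_mul_roundedInner,
    integral_inner_mul_roundedInner, real_inner_comm a b, ← hk, ← hk2]
  ring

/-- **Gaussian rounding** of a Gram matrix of vectors, for a positive semidefinite form. -/
theorem exists_rounding {ι : Type*} [Fintype ι] {H : Matrix ι ι ℝ} (hH : H.PosSemidef)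
    (v : ι → E) :
    ∃ x : ι → ℝ, (∀ i, |x i| ≤ ‖v i‖) ∧
      2 / Real.pi * ∑ i, ∑ j, H i j * ⟪v i, v j⟫ ≤ x ⬝ᵥ (H *ᵥ x) := by
  have hform : ∀ y : ι → ℝ, y ⬝ᵥ (H *ᵥ y) = ∑ i, ∑ j, H i j * (y i * y j) := by
    intro y
    simp only [dotProduct, Matrix.mulVec, Finset.mul_sum]
    exact Finset.sum_congr rfl fun i _ => Finset.sum_congr rfl fun j _ => by ring
  have hS := integral_sum_mul (stdGaussian E) H (fun i j x => roundedInner (v i) x *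
    roundedInner (v j) x) fun i j => integrable_roundedInner_mul_roundedInner _ _
  have hD := integral_sum_mul (stdGaussian E) H (fun i j x =>
    (Real.sqrt (2 / Real.pi) * ⟪v i, x⟫ - roundedInner (v i) x) *
      (Real.sqrt (2 / Real.pi) * ⟪v j, x⟫ - roundedInner (v j) x))
    fun i j => (integral_residual_mul_residual _ _).1
  -- Some sample does at least as well as the mean.
  obtain ⟨x, hx⟩ := exists_integral_le hS.1
  refine ⟨fun i => roundedInner (v i) x, fun i => abs_roundedInner_le _ _, ?_⟩
  rw [hform]
  refine le_trans ?_ hx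
  -- The form is nonnegative at every residual vector; its mean is exactly the difference of the two
  -- sides.
  have hnn := integral_nonneg (μ := stdGaussian E) (f := fun x => ∑ i, ∑ j, H i j *
    ((Real.sqrt (2 / Real.pi) * ⟪v i, x⟫ - roundedInner (v i) x) *
      (Real.sqrt (2 / Real.pi) * ⟪v j, x⟫ - roundedInner (v j) x))) fun x => by
    have := hH.dotProduct_mulVec_nonneg
      (fun i => Real.sqrt (2 / Real.pi) * ⟪v i, x⟫ - roundedInner (v i) x)
    simp only [star_trivial] at this
    rwa [hform] at this
  rw [hD.2] at hnn
  rw [hS.2, ← sub_nonneg, Finset.mul_sum, ← Finset.sum_sub_distrib]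
  refine hnn.trans_eq (Finset.sum_congr rfl fun i _ => ?_)
  rw [Finset.mul_sum, ← Finset.sum_sub_distrib]
  refine Finset.sum_congr rfl fun j _ => ?_
  rw [(integral_residual_mul_residual _ _).2]
  ring

end Gaussian

/-! ### Conic duality for a positive semidefinite form on a product of balls -/

/-- A linear function bounded above on a ray has nonpositive slope: this is how signs are read off
the separating functional. -/
theorem nonpos_of_forall_mul_lt {a c : ℝ} (h : ∀ t : ℝ, 0 ≤ t → t * a < c) : a ≤ 0 := by
  by_contra! ha
  have h1 := h (|c| / a) (by positivity)
  rw [div_mul_cancel₀ _ ha.ne'] at h1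
  exact absurd (le_abs_self c) (not_le.mpr h1)

section Duality

variable {ι β : Type*} [Fintype ι]

theorem dotProduct_mulVec_eq_sum (H : Matrix ι ι ℝ) (x : ι → ℝ) :
    x ⬝ᵥ (H *ᵥ x) = ∑ i, ∑ j, H i j * (x i * x j) := by
  simp only [dotProduct, Matrix.mulVec, Finset.mul_sum]
  exact Finset.sum_congr rfl fun i _ => Finset.sum_congr rfl fun j _ => by ring

-- Write `X = Bᵀ B` and round the columns of `B`, whose Gram matrix is `X`.
open scoped MatrixOrder in
theorem exists_rounding_of_posSemidef {H X : Matrix ι ι ℝ} (hH : H.PosSemidef)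
    (hX : X.PosSemidef) :
    ∃ x : ι → ℝ, (∀ i, x i ^ 2 ≤ X i i) ∧
      2 / Real.pi * ∑ i, ∑ j, H i j * X i j ≤ x ⬝ᵥ (H *ᵥ x) := by
  classical
  obtain ⟨B, hB⟩ := CStarAlgebra.nonneg_iff_eq_star_mul_self.mp hX.nonneg
  set v : ι → EuclideanSpace ℝ ι := fun i => WithLp.toLp 2 fun k => B k i
  have hv : ∀ i j, inner ℝ (v i) (v j) = X i j := by
    intro i j
    rw [hB]
    simp [v, PiLp.inner_apply, Matrix.mul_apply, Matrix.star_eq_conjTranspose, mul_comm]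
  obtain ⟨x, hx, hx'⟩ := exists_rounding hH v
  refine ⟨x, fun i => ?_, ?_⟩
  · rw [← hv, real_inner_self_eq_norm_sq]
    exact sq_le_sq' (by linarith [neg_le_of_abs_le (hx i)]) (le_of_abs_le (hx i))
  · simpa only [hv] using hx'

variable [DecidableEq β]

/-- The bounds on the values and the block traces of the matrices in the semidefinite cone. -/
def shadowCone (H : Matrix ι ι ℝ) (b : ι → β) : Set (ℝ × (β → ℝ)) :=
  {p | ∃ X : Matrix ι ι ℝ, X.PosSemidef ∧ p.1 < ∑ i, ∑ j, H i j * X i j ∧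
    ∀ c, ∑ i with b i = c, X i i < p.2 c}

/-- The strict inequalities make this a union of open sets, one for each `X`. Separation then needs
no closedness of an image of the semidefinite cone and no Slater condition. -/
theorem isOpen_shadowCone [Finite β] (H : Matrix ι ι ℝ) (b : ι → β) : IsOpen (shadowCone H b) := by
  have : shadowCone H b = ⋃ X : {X : Matrix ι ι ℝ // X.PosSemidef},
      {p : ℝ × (β → ℝ) | p.1 < ∑ i, ∑ j, H i j * X.1 i j ∧
        ∀ c, ∑ i with b i = c, X.1 i i < p.2 c} := by
    ext p
    simp [shadowCone, and_left_comm]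
  rw [this]
  refine isOpen_iUnion fun X => ?_
  simp only [Set.ofPred_and, Set.ofPred_forall]
  refine (isOpen_lt (by fun_prop) (by fun_prop)).inter (isOpen_iInter_of_finite fun c => ?_)
  exact isOpen_lt (by fun_prop) (by fun_prop)

theorem convex_shadowCone (H : Matrix ι ι ℝ) (b : ι → β) : Convex ℝ (shadowCone H b) := by
  rw [convex_iff_forall_pos]
  rintro p ⟨X, hX, hX1, hX2⟩ q ⟨Y, hY, hY1, hY2⟩ s t hs ht -
  refine ⟨s • X + t • Y, (hX.smul hs.le).add (hY.smul ht.le), ?_, fun c => ?_⟩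
  · have : ∑ i, ∑ j, H i j * (s • X + t • Y) i j =
        s * ∑ i, ∑ j, H i j * X i j + t * ∑ i, ∑ j, H i j * Y i j := by
      simp only [Finset.mul_sum, ← Finset.sum_add_distrib]
      refine Finset.sum_congr rfl fun i _ => Finset.sum_congr rfl fun j _ => ?_
      simp; ring
    rw [this]
    simp only [Prod.fst_add, Prod.smul_fst, smul_eq_mul]
    exact add_lt_add (mul_lt_mul_of_pos_left hX1 hs) (mul_lt_mul_of_pos_left hY1 ht)
  · simp only [Matrix.add_apply, Matrix.smul_apply, smul_eq_mul, Finset.sum_add_distrib,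
      ← Finset.mul_sum, Prod.snd_add, Prod.smul_snd, Pi.add_apply, Pi.smul_apply]
    exact add_lt_add (mul_lt_mul_of_pos_left (hX2 c) hs) (mul_lt_mul_of_pos_left (hY2 c) ht)

/-- A bound `v` for a positive semidefinite form on a product of Euclidean unit balls is certified
by multipliers, up to the factor `π / 2`. -/
theorem exists_multipliers [Fintype β] {H : Matrix ι ι ℝ} (hH : H.PosSemidef) (b : ι → β) (v : ℝ)
    (hv : ∀ x : ι → ℝ, (∀ c, ∑ i with b i = c, x i ^ 2 ≤ 1) → x ⬝ᵥ (H *ᵥ x) ≤ v) :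
    ∃ lam : β → ℝ, (∀ c, 0 ≤ lam c) ∧ ∑ c, lam c ≤ Real.pi / 2 * v ∧
      ∀ y : ι → ℝ, y ⬝ᵥ (H *ᵥ y) ≤ ∑ i, lam (b i) * y i ^ 2 := by
  -- A matrix witnessing membership would round to a point of the product of balls at which the form
  -- exceeds `v`.
  have hpt : (Real.pi / 2 * v, fun _ => 1) ∉ shadowCone H b := by
    rintro ⟨X, hX, h1, h2⟩
    obtain ⟨x, hx, hx'⟩ := exists_rounding_of_posSemidef hH hX
    have h3 := hv x fun c => (Finset.sum_le_sum fun i _ => hx i).trans (h2 c).le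
    have h4 := mul_lt_mul_of_pos_left h1 (show 0 < 2 / Real.pi by positivity)
    have h5 : 2 / Real.pi * (Real.pi / 2 * v) = v := by field_simp
    simp only [h5] at h4
    linarith
  obtain ⟨f, hf⟩ := geometric_hahn_banach_open_point (convex_shadowCone H b)
    (isOpen_shadowCone H b) hpt
  set α := f (1, 0)
  set μ : β → ℝ := fun c => f (0, Pi.single c 1)
  have hfe : ∀ h d, f (h, d) = α * h + ∑ c, μ c * d c := by
    intro h d
    have : (h, d) = h • ((1, 0) : ℝ × (β → ℝ)) +
        ∑ c, d c • ((0, Pi.single c 1) : ℝ × (β → ℝ)) := by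
      refine Prod.ext ?_ ?_
      · simp [Prod.fst_sum]
      · ext c
        simp [Prod.snd_sum, Finset.sum_apply, Pi.single_apply]
    rw [this, map_add, map_smul, map_sum]
    simp only [map_smul, smul_eq_mul]
    rw [mul_comm]
    exact congrArg _ (Finset.sum_congr rfl fun c _ => mul_comm _ _)
  have key : ∀ X : Matrix ι ι ℝ, X.PosSemidef → ∀ (h : ℝ) (d : β → ℝ), h < ∑ i, ∑ j, H i j * X i j →
      (∀ c, ∑ i with b i = c, X i i < d c) →
      α * h + ∑ c, μ c * d c < α * (Real.pi / 2 * v) + ∑ c, μ c := by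
    intro X hX h d h1 h2
    have := hf (h, d) ⟨X, hX, h1, h2⟩
    rw [hfe, hfe] at this
    simpa using this
  -- The zero matrix alone determines the signs of `α` and `μ`.
  have key0 : ∀ h (d : β → ℝ), h < 0 → (∀ c, 0 < d c) →
      α * h + ∑ c, μ c * d c < α * (Real.pi / 2 * v) + ∑ c, μ c := by
    intro h d h1 h2
    exact key 0 .zero h d (by simpa using h1) (by simpa using h2)
  have hα0 : 0 ≤ α := by
    have : -α ≤ 0 := nonpos_of_forall_mul_lt (c := α * (Real.pi / 2 * v) + α) fun t ht => by
      have := key0 (-t - 1) (fun _ => 1) (by linarith) (fun _ => one_pos)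
      simp only [mul_one] at this
      linarith
    linarith
  have hμ : ∀ c, μ c ≤ 0 := by
    intro c
    refine nonpos_of_forall_mul_lt (c := α * (Real.pi / 2 * v) + α) fun t ht => ?_
    have := key0 (-1) (fun e => 1 + t * (Pi.single c 1 : β → ℝ) e) (by norm_num) (fun e => by
      have : 0 ≤ (Pi.single c 1 : β → ℝ) e := by
        rw [Pi.single_apply]; split_ifs <;> norm_num
      positivity)
    have e : ∑ e, μ e * (1 + t * (Pi.single c 1 : β → ℝ) e) = ∑ e, μ e + t * μ c := by
      simp only [mul_add, mul_one, Finset.sum_add_distrib, Pi.single_apply]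
      simp [mul_comm]
    rw [e] at this
    linarith
  -- If `α = 0`, the traces `1 / 2` and `1` would give `∑ μ / 2 < ∑ μ`, against `μ ≤ 0`.
  have hα : 0 < α := by
    rcases hα0.eq_or_lt with h0 | h0
    · have := key0 (-1) (fun _ => 1 / 2) (by norm_num) (fun _ => by norm_num)
      rw [← h0, ← Finset.sum_mul] at this
      have h2 : ∑ c, μ c ≤ 0 := Finset.sum_nonpos fun c _ => hμ c
      linarith
    · exact h0
  refine ⟨fun c => -μ c / α, fun c => div_nonneg (neg_nonneg.mpr (hμ c)) hα.le, ?_, fun y => ?_⟩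
  · have h0 : -(α * (Real.pi / 2 * v) + ∑ c, μ c) ≤ 0 := by
      refine nonpos_of_forall_mul_lt (c := α - ∑ c, μ c +
        (α * (Real.pi / 2 * v) + ∑ c, μ c)) fun t ht => ?_
      have := key0 (-(1 / (t + 1))) (fun _ => 1 / (t + 1)) (by simp; positivity)
        (fun _ => by positivity)
      rw [← Finset.sum_mul] at this
      have h3 := mul_lt_mul_of_pos_left this (show 0 < t + 1 by positivity)
      have h4 : (t + 1) * (α * -(1 / (t + 1)) + (∑ c, μ c) * (1 / (t + 1))) =
          -α + ∑ c, μ c := by field_simp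
      rw [h4] at h3
      linarith
    rw [← Finset.sum_div, Finset.sum_neg_distrib, div_le_iff₀ hα]
    linarith
  · have hle : α * (y ⬝ᵥ (H *ᵥ y)) + ∑ c, μ c * ∑ i with b i = c, y i ^ 2 ≤ 0 := by
      refine nonpos_of_forall_mul_lt (c := α * (Real.pi / 2 * v) + α) fun t ht => ?_
      have hy : (t • Matrix.vecMulVec y y).PosSemidef := by
        have := Matrix.posSemidef_vecMulVec_self_star y
        rw [star_trivial] at this
        exact this.smul ht
      have hyH : ∑ i, ∑ j, H i j * (t • Matrix.vecMulVec y y) i j = t * (y ⬝ᵥ (H *ᵥ y)) := by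
        rw [dotProduct_mulVec_eq_sum]
        simp only [Finset.mul_sum]
        refine Finset.sum_congr rfl fun i _ => Finset.sum_congr rfl fun j _ => ?_
        simp [Matrix.vecMulVec_apply]; ring
      have hyd : ∀ c, ∑ i with b i = c, (t • Matrix.vecMulVec y y) i i =
          t * ∑ i with b i = c, y i ^ 2 := by
        intro c
        rw [Finset.mul_sum]
        exact Finset.sum_congr rfl fun i _ => by simp [Matrix.vecMulVec_apply, sq]
      have := key _ hy (t * (y ⬝ᵥ (H *ᵥ y)) - 1) (fun c => t * ∑ i with b i = c, y i ^ 2 + 1)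
        (by rw [hyH]; linarith) (fun c => by rw [hyd]; linarith)
      have e : ∑ c, μ c * (t * ∑ i with b i = c, y i ^ 2 + 1) =
          t * ∑ c, μ c * ∑ i with b i = c, y i ^ 2 + ∑ c, μ c := by
        rw [Finset.mul_sum, ← Finset.sum_add_distrib]
        exact Finset.sum_congr rfl fun c _ => by ring
      rw [e] at this
      linarith
    have hsum : ∑ i, -μ (b i) / α * y i ^ 2 =
        -(∑ c, μ c * ∑ i with b i = c, y i ^ 2) / α := by
      rw [← Finset.sum_fiberwise Finset.univ b, ← Finset.sum_neg_distrib, Finset.sum_div]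
      refine Finset.sum_congr rfl fun c _ => ?_
      rw [Finset.mul_sum, ← Finset.sum_neg_distrib, Finset.sum_div]
      refine Finset.sum_congr rfl fun i hi => ?_
      rw [(Finset.mem_filter.mp hi).2]
      ring
    rw [hsum, le_div_iff₀ hα]
    linarith

end Duality

/-! ### Block triangular matrices -/

section Triangular

variable {ι α : Type*} [LinearOrder α]

theorem one_sub_apply_eq_zero_of_strictLower [DecidableEq ι] {b : ι → α} {N : Matrix ι ι ℝ}
    (hN : ∀ i j, b i ≤ b j → N i j = 0) (i j : ι) (hij : b i < b j) : (1 - N) i j = 0 := by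
  rw [Matrix.sub_apply, hN i j hij.le, Matrix.one_apply_ne (fun h => by simp [h] at hij), sub_zero]

variable [Fintype ι]

theorem mul_apply_eq_zero_of_lower {κ τ : Type*} {a : κ → α} {b : ι → α} {c : τ → α}
    {M : Matrix κ ι ℝ} {N : Matrix ι τ ℝ} (hM : ∀ i j, a i < b j → M i j = 0)
    (hN : ∀ i j, b i < c j → N i j = 0) (i : κ) (j : τ) (hij : a i < c j) : (M * N) i j = 0 := by
  refine Finset.sum_eq_zero fun k _ => ?_
  change M i k * N k j = 0
  rcases lt_or_ge (a i) (b k) with h | h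
  · rw [hM i k h, zero_mul]
  · rw [hN k j (h.trans_lt hij), mul_zero]

/-- Each block of `N v` involves only earlier blocks of `v`, so well-founded induction on the block
applies. -/
theorem eq_zero_of_eq_mulVec [WellFoundedLT α] {b : ι → α} {N : Matrix ι ι ℝ}
    (hN : ∀ i j, b i ≤ b j → N i j = 0) {v : ι → ℝ} (hv : v = N *ᵥ v) : v = 0 := by
  have h : ∀ a, ∀ i, b i = a → v i = 0 := by
    intro a
    induction a using WellFoundedLT.induction with
    | ind a ih =>
      rintro i rfl
      rw [hv]
      refine Finset.sum_eq_zero fun j _ => ?_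
      change N i j * v j = 0
      rcases lt_or_ge (b j) (b i) with hj | hj
      · rw [ih _ hj j rfl, mul_zero]
      · rw [hN i j hj, zero_mul]
  exact funext fun i => h _ i rfl

variable [DecidableEq ι]

theorem isUnit_one_sub_of_strictLower [WellFoundedLT α] {b : ι → α} {N : Matrix ι ι ℝ}
    (hN : ∀ i j, b i ≤ b j → N i j = 0) : IsUnit (1 - N) := by
  rw [← Matrix.mulVec_injective_iff_isUnit]
  intro x y hxy
  have h : x - y = N *ᵥ (x - y) := by
    have : (1 - N) *ᵥ (x - y) = 0 := by rw [Matrix.mulVec_sub]; exact sub_eq_zero.mpr hxy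
    rw [Matrix.sub_mulVec, Matrix.one_mulVec] at this
    exact sub_eq_zero.mp this
  exact sub_eq_zero.mp (eq_zero_of_eq_mulVec hN h)

theorem inv_apply_eq_zero_of_lower {b : ι → α} {M : Matrix ι ι ℝ} (hu : IsUnit M)
    (hM : ∀ i j, b i < b j → M i j = 0) (i j : ι) (hij : b i < b j) : M⁻¹ i j = 0 := by
  have := hu.invertible
  -- `Matrix.BlockTriangular` means upper triangular; the order dual makes it lower.
  have h : M.BlockTriangular (OrderDual.toDual ∘ b) := fun i j hij => hM i j hij
  exact Matrix.blockTriangular_inv_of_blockTriangular h hij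

end Triangular

/-! ### Minimising a sum of two quadratic forms -/

section Quadratic

variable {ι κ : Type*} [Fintype ι] [Fintype κ]

theorem dotProduct_mulVec_comm_of_posDef {Q : Matrix ι ι ℝ} (hQ : Q.PosDef) (x y : ι → ℝ) :
    x ⬝ᵥ (Q *ᵥ y) = y ⬝ᵥ (Q *ᵥ x) := by
  have : Qᵀ = Q := by simpa using hQ.isHermitian.eq
  rw [Matrix.dotProduct_mulVec, ← Matrix.mulVec_transpose, this, dotProduct_comm]

theorem dotProduct_mul_mul_transpose (F : Matrix ι κ ℝ) (M : Matrix κ κ ℝ) (p : ι → ℝ) :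
    p ⬝ᵥ ((F * M * Fᵀ) *ᵥ p) = (Fᵀ *ᵥ p) ⬝ᵥ (M *ᵥ (Fᵀ *ᵥ p)) := by
  rw [Matrix.mul_assoc, ← Matrix.mulVec_mulVec, ← Matrix.mulVec_mulVec, Matrix.dotProduct_mulVec,
    ← Matrix.mulVec_transpose]

variable [DecidableEq ι]

theorem mulVec_inv_mulVec {Q : Matrix ι ι ℝ} (hQ : Q.PosDef) (p : ι → ℝ) :
    Q *ᵥ (Q⁻¹ *ᵥ p) = p := by
  rw [Matrix.mulVec_mulVec, Matrix.mul_nonsing_inv _ ((Matrix.isUnit_iff_isUnit_det _).mp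
    hQ.isUnit), Matrix.one_mulVec]

/-- Fenchel–Young: expand the square of `x - Q⁻¹ p` in the form `Q`. -/
theorem two_mul_dotProduct_le {Q : Matrix ι ι ℝ} (hQ : Q.PosDef) (x p : ι → ℝ) :
    2 * (p ⬝ᵥ x) ≤ x ⬝ᵥ (Q *ᵥ x) + p ⬝ᵥ (Q⁻¹ *ᵥ p) := by
  have h := hQ.posSemidef.dotProduct_mulVec_nonneg (x - Q⁻¹ *ᵥ p)
  rw [star_trivial, Matrix.mulVec_sub, mulVec_inv_mulVec hQ, sub_dotProduct, dotProduct_sub,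
    dotProduct_sub, dotProduct_mulVec_comm_of_posDef hQ (Q⁻¹ *ᵥ p), mulVec_inv_mulVec hQ,
    dotProduct_comm x p, dotProduct_comm (Q⁻¹ *ᵥ p) p] at h
  linarith

variable [DecidableEq κ] {Q : Matrix ι ι ℝ} {R : Matrix κ κ ℝ} (F : Matrix ι κ ℝ)

theorem posDef_inv_add (hQ : Q.PosDef) (hR : R.PosDef) : (Q⁻¹ + F * R⁻¹ * Fᵀ).PosDef := by
  refine hQ.inv.add_posSemidef ?_
  simpa using hR.inv.posSemidef.mul_mul_conjTranspose_same F

/-- Weak duality: apply Fenchel–Young to the state with dual vector `p` and to the input with `-Fᵀ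
p`; the terms in `F u` cancel. -/
theorem le_add_form (hQ : Q.PosDef) (hR : R.PosDef) (z : ι → ℝ) (u : κ → ℝ) :
    z ⬝ᵥ ((Q⁻¹ + F * R⁻¹ * Fᵀ)⁻¹ *ᵥ z) ≤
      (F *ᵥ u + z) ⬝ᵥ (Q *ᵥ (F *ᵥ u + z)) + u ⬝ᵥ (R *ᵥ u) := by
  set p := (Q⁻¹ + F * R⁻¹ * Fᵀ)⁻¹ *ᵥ z with hp
  have hz : (Q⁻¹ + F * R⁻¹ * Fᵀ) *ᵥ p = z := mulVec_inv_mulVec (posDef_inv_add F hQ hR) z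
  have h1 := two_mul_dotProduct_le hQ (F *ᵥ u + z) p
  have h2 := two_mul_dotProduct_le hR u (-(Fᵀ *ᵥ p))
  have h3 : p ⬝ᵥ z = p ⬝ᵥ (Q⁻¹ *ᵥ p) + (Fᵀ *ᵥ p) ⬝ᵥ (R⁻¹ *ᵥ (Fᵀ *ᵥ p)) := by
    conv_lhs => rw [← hz]
    rw [Matrix.add_mulVec, dotProduct_add, dotProduct_mul_mul_transpose]
  have h4 : (Fᵀ *ᵥ p) ⬝ᵥ u = p ⬝ᵥ (F *ᵥ u) := by
    rw [Matrix.mulVec_transpose, Matrix.dotProduct_mulVec]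
  rw [dotProduct_add] at h1
  rw [neg_dotProduct, Matrix.mulVec_neg, neg_dotProduct_neg, h4] at h2
  rw [dotProduct_comm z p]
  linarith

/-- At `u = -R⁻¹ Fᵀ p` the state is `Q⁻¹ p`, which is the equality case of both Fenchel–Young
inequalities. -/
theorem exists_add_form_eq (hQ : Q.PosDef) (hR : R.PosDef) (z : ι → ℝ) :
    ∃ u : κ → ℝ, (F *ᵥ u + z) ⬝ᵥ (Q *ᵥ (F *ᵥ u + z)) + u ⬝ᵥ (R *ᵥ u) =
      z ⬝ᵥ ((Q⁻¹ + F * R⁻¹ * Fᵀ)⁻¹ *ᵥ z) := by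
  set p := (Q⁻¹ + F * R⁻¹ * Fᵀ)⁻¹ *ᵥ z with hp
  have hz : (Q⁻¹ + F * R⁻¹ * Fᵀ) *ᵥ p = z := mulVec_inv_mulVec (posDef_inv_add F hQ hR) z
  refine ⟨-(R⁻¹ *ᵥ (Fᵀ *ᵥ p)), ?_⟩
  have hx : F *ᵥ (-(R⁻¹ *ᵥ (Fᵀ *ᵥ p))) + z = Q⁻¹ *ᵥ p := by
    conv_lhs => rw [← hz]
    rw [Matrix.add_mulVec, Matrix.mulVec_neg, Matrix.mulVec_mulVec, Matrix.mulVec_mulVec]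
    rw [neg_add_eq_sub, add_sub_assoc, sub_self, add_zero]
  rw [hx, mulVec_inv_mulVec hQ, Matrix.mulVec_neg, mulVec_inv_mulVec hR, neg_dotProduct_neg]
  conv_rhs => rw [← hz]
  rw [Matrix.add_mulVec, add_dotProduct, dotProduct_comm _ p, dotProduct_comm _ p,
    dotProduct_mul_mul_transpose, dotProduct_comm (R⁻¹ *ᵥ _)]

end Quadratic

/-! ### The dynamics in stacked form -/

theorem shift_mulVec_zero {n T : ℕ} (v : Stk n T → ℝ) (i : Fin n) :
    (shift n T *ᵥ v) (i, 0) = 0 := by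
  refine Finset.sum_eq_zero fun q _ => ?_
  simp [shift]

theorem shift_mulVec_succ {n T : ℕ} (v : Stk n T → ℝ) (i : Fin n) (k : Fin T) :
    (shift n T *ᵥ v) (i, k.succ) = v (i, k.castSucc) := by
  rw [Matrix.mulVec, dotProduct, Finset.sum_eq_single (i, k.castSucc)]
  · simp [shift]
  · rintro ⟨j, l⟩ - h
    have : ¬ (i = j ∧ (k.succ : ℕ) = (l : ℕ) + 1) := by
      rintro ⟨rfl, h2⟩
      refine h (Prod.ext rfl (Fin.ext ?_))
      simp only [Fin.val_succ] at h2
      simp only [Fin.val_castSucc]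
      omega
    simp only [shift, Matrix.of_apply, if_neg this, zero_mul]
  · simp

/-- The one-step delay turns lower into strictly lower triangular, which is what makes every
feedback loop well posed. -/
theorem shift_mul_apply_eq_zero {n T : ℕ} {ι : Type*} {b : ι → Fin (T + 1)}
    {M : Matrix (Stk n T) ι ℝ} (hM : ∀ p q, p.2 < b q → M p q = 0) (p : Stk n T) (q : ι)
    (hpq : p.2 ≤ b q) : (shift n T * M) p q = 0 := by
  have h : (shift n T * M) p q = (shift n T *ᵥ M.col q) p := rfl
  obtain ⟨i, k⟩ := p
  induction k using Fin.cases with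
  | zero => rw [h, shift_mulVec_zero]
  | succ k =>
    rw [h, shift_mulVec_succ]
    exact hM _ _ (lt_of_lt_of_le (Fin.castSucc_lt_succ) hpq)

theorem blockDiagonal_mulVec_apply {n m k : ℕ} (M : Fin k → Matrix (Fin n) (Fin m) ℝ)
    (v : Fin m × Fin k → ℝ) (i : Fin n) (j : Fin k) :
    (Matrix.blockDiagonal M *ᵥ v) (i, j) = (M j *ᵥ fun l => v (l, j)) i := by
  simp only [Matrix.mulVec, dotProduct, Fintype.sum_prod_type, Matrix.blockDiagonal_apply, ite_mul,
    zero_mul, Finset.sum_ite_eq, Finset.mem_univ, if_true]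

theorem blockDiagonal_apply_eq_zero {n m k : ℕ} (M : Fin k → Matrix (Fin n) (Fin m) ℝ)
    (p : Fin n × Fin k) (q : Fin m × Fin k) (h : p.2 < q.2) : Matrix.blockDiagonal M p q = 0 :=
  Matrix.blockDiagonal_apply_ne _ _ _ h.ne

theorem posDef_blockDiagonal {n k : ℕ} {M : Fin k → Matrix (Fin n) (Fin n) ℝ}
    (hM : ∀ j, (M j).PosDef) : (Matrix.blockDiagonal M).PosDef := by
  refine Matrix.PosDef.of_dotProduct_mulVec_pos ?_ fun x hx => ?_
  · rw [Matrix.IsHermitian, Matrix.blockDiagonal_conjTranspose]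
    exact congrArg _ (funext fun j => (hM j).isHermitian)
  · have e : star x ⬝ᵥ (Matrix.blockDiagonal M *ᵥ x) =
        ∑ j, star (fun i => x (i, j)) ⬝ᵥ (M j *ᵥ fun i => x (i, j)) := by
      simp only [dotProduct, Fintype.sum_prod_type_right, blockDiagonal_mulVec_apply]
      rfl
    rw [e]
    obtain ⟨⟨i, j⟩, hij⟩ := Function.ne_iff.mp hx
    refine Finset.sum_pos' (fun j _ => (hM j).posSemidef.dotProduct_mulVec_nonneg _)
      ⟨j, Finset.mem_univ _, (hM j).dotProduct_mulVec_pos fun h => hij (congrFun h i)⟩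

/-- The stacked disturbance. -/
def stackDst {r T : ℕ} (w : Fin T → Fin r → ℝ) : Dst r T → ℝ := fun p => w p.2 p.1

/-- The sequence of blocks of a stacked vector. -/
def unstack {n k : ℕ} (v : Fin n × Fin k → ℝ) : Fin k → Fin n → ℝ := fun j i => v (i, j)

namespace Plant

variable {n m r T : ℕ} (S : Plant n m r T)

theorem calE_mulVec_zero (a : Fin n → ℝ) (w : Dst r T → ℝ) (i : Fin n) :
    (S.calE *ᵥ Sum.elim a w) (i, 0) = a i := by
  rw [Matrix.mulVec, dotProduct, Fintype.sum_sum_type]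
  simp [calE, (Fin.succ_ne_zero _).symm]

theorem calE_mulVec_succ (a : Fin n → ℝ) (w : Dst r T → ℝ) (i : Fin n) (k : Fin T) :
    (S.calE *ᵥ Sum.elim a w) (i, k.succ) = (S.E k *ᵥ unstack w k) i := by
  rw [Matrix.mulVec, dotProduct, Fintype.sum_sum_type]
  simp [Matrix.mulVec, dotProduct, calE, Fintype.sum_prod_type, unstack]

theorem calE_apply_eq_zero (p : Stk n T) (q : Dlt n r T) (h : p.2 ≠ Dlt.block q) :
    S.calE p q = 0 := by
  rcases q with j | ⟨j, l⟩
  · exact if_neg fun h' => h h'.1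
  · exact if_neg h

theorem shift_calA_apply_eq_zero (p q : Stk n T) (h : p.2 ≤ q.2) :
    (shift n T * S.calA) p q = 0 :=
  shift_mul_apply_eq_zero (b := Prod.snd) (blockDiagonal_apply_eq_zero _) p q h

theorem shift_calB_mul_apply_eq_zero {K : Matrix (Stk m T) (Stk n T) ℝ} (hK : CausalGain K)
    (p q : Stk n T) (h : p.2 ≤ q.2) : (shift n T * (S.calB * K)) p q = 0 :=
  shift_mul_apply_eq_zero (b := Prod.snd)
    (mul_apply_eq_zero_of_lower (b := Prod.snd) (blockDiagonal_apply_eq_zero _) hK) p q h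

/-- The stacked form of the dynamics. -/
def StackedDynamics (x : Stk n T → ℝ) (u : Stk m T → ℝ) (d : Dlt n r T → ℝ) : Prop :=
  x = (shift n T * S.calA) *ᵥ x + (shift n T * S.calB) *ᵥ u + S.calE *ᵥ d

theorem stackedDynamics_iff_state (x : Stk n T → ℝ) (u : Fin (T + 1) → Fin m → ℝ)
    (w : Fin T → Fin r → ℝ) :
    S.StackedDynamics x (stack u) (Sum.elim S.x0 (stackDst w)) ↔ x = stack (S.state u w) := by
  have h0 : ∀ i, ((shift n T * S.calA) *ᵥ x + (shift n T * S.calB) *ᵥ stack u +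
      S.calE *ᵥ Sum.elim S.x0 (stackDst w)) (i, 0) = S.x0 i := by
    intro i
    rw [Pi.add_apply, Pi.add_apply, ← Matrix.mulVec_mulVec, ← Matrix.mulVec_mulVec,
      shift_mulVec_zero, shift_mulVec_zero, calE_mulVec_zero, zero_add, zero_add]
  have h1 : ∀ (i) (k : Fin T), ((shift n T * S.calA) *ᵥ x + (shift n T * S.calB) *ᵥ stack u +
      S.calE *ᵥ Sum.elim S.x0 (stackDst w)) (i, k.succ) =
      (S.A k *ᵥ unstack x k.castSucc + S.B k *ᵥ u k.castSucc + S.E k *ᵥ w k) i := by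
    intro i k
    rw [Pi.add_apply, Pi.add_apply, ← Matrix.mulVec_mulVec, ← Matrix.mulVec_mulVec,
      shift_mulVec_succ, shift_mulVec_succ, calE_mulVec_succ, calA, calB,
      blockDiagonal_mulVec_apply, blockDiagonal_mulVec_apply, Fin.snoc_castSucc, Fin.snoc_castSucc]
    rfl
  have hs : ∀ k : Fin T, S.state u w k.succ =
      S.A k *ᵥ S.state u w k.castSucc + S.B k *ᵥ u k.castSucc + S.E k *ᵥ w k := fun k => rfl
  constructor
  · intro h
    have hx0 : ∀ i, x (i, 0) = S.x0 i := fun i => by rw [← h0 i]; exact congrFun h (i, 0)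
    have hx1 : ∀ i (k : Fin T), x (i, k.succ) =
        (S.A k *ᵥ unstack x k.castSucc + S.B k *ᵥ u k.castSucc + S.E k *ᵥ w k) i :=
      fun i k => by rw [← h1 i k]; exact congrFun h (i, k.succ)
    have : ∀ k, unstack x k = S.state u w k := by
      intro k
      induction k using Fin.induction with
      | zero => exact funext hx0
      | succ k ih =>
        rw [hs, ← ih]
        exact funext fun i => hx1 i k
    exact funext fun p => congrFun (this p.2) p.1
  · rintro rfl
    funext ⟨i, k⟩
    induction k using Fin.cases with
    | zero => rw [h0]; rfl
    | succ k => rw [h1]; exact congrFun (hs k) i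

theorem isUnit_one_sub_shift_calA : IsUnit (1 - shift n T * S.calA) :=
  isUnit_one_sub_of_strictLower (b := Prod.snd) S.shift_calA_apply_eq_zero

theorem stackedDynamics_iff (x : Stk n T → ℝ) (u : Stk m T → ℝ) (d : Dlt n r T → ℝ) :
    S.StackedDynamics x u d ↔ x = S.calF *ᵥ u + S.calG *ᵥ d := by
  have hdet := (Matrix.isUnit_iff_isUnit_det _).mp S.isUnit_one_sub_shift_calA
  have e : S.calF *ᵥ u + S.calG *ᵥ d = (1 - shift n T * S.calA)⁻¹ *ᵥ
      ((shift n T * S.calB) *ᵥ u + S.calE *ᵥ d) := by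
    rw [calF, calG, Matrix.mulVec_add, Matrix.mulVec_mulVec, Matrix.mulVec_mulVec]
  have e2 : S.StackedDynamics x u d ↔ (1 - shift n T * S.calA) *ᵥ x =
      (shift n T * S.calB) *ᵥ u + S.calE *ᵥ d := by
    rw [StackedDynamics, Matrix.sub_mulVec, Matrix.one_mulVec, sub_eq_iff_eq_add, add_assoc,
      add_comm (_ + _) ((shift n T * S.calA) *ᵥ x)]
  rw [e, e2]
  constructor
  · intro h
    rw [← h, Matrix.mulVec_mulVec, Matrix.nonsing_inv_mul _ hdet, Matrix.one_mulVec]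
  · rintro rfl
    rw [Matrix.mulVec_mulVec, Matrix.mul_nonsing_inv _ hdet, Matrix.one_mulVec]

variable {S}

theorem isResponse_iff {Φ : Matrix (Stk n T ⊕ Stk m T) (Dlt n r T) ℝ} :
    S.IsResponse Φ ↔ CausalMap Φ.toRows₁ ∧ CausalMap Φ.toRows₂ ∧
      Φ.toRows₁ = shift n T * S.calA * Φ.toRows₁ + shift n T * S.calB * Φ.toRows₂ + S.calE := by
  rw [IsResponse]
  refine and_congr_right fun _ => and_congr_right fun _ => ?_
  conv_lhs => rw [← Matrix.fromRows_toRows Φ, Matrix.fromCols_mul_fromRows, Matrix.sub_mul,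
    Matrix.one_mul, Matrix.neg_mul]
  rw [← sub_eq_add_neg, sub_sub, sub_eq_iff_eq_add, add_comm S.calE]

theorem IsResponse.stackedDynamics {Φ : Matrix (Stk n T ⊕ Stk m T) (Dlt n r T) ℝ}
    (hΦ : S.IsResponse Φ) (d : Dlt n r T → ℝ) :
    S.StackedDynamics (Φ.toRows₁ *ᵥ d) (Φ.toRows₂ *ᵥ d) d := by
  rw [StackedDynamics]
  conv_lhs => rw [(isResponse_iff.mp hΦ).2.2]
  rw [Matrix.add_mulVec, Matrix.add_mulVec, Matrix.mulVec_mulVec, Matrix.mulVec_mulVec]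

/-- The closed loop of a feedback that factors a response follows that response. -/
theorem IsResponse.closedLoop_iff {Φ : Matrix (Stk n T ⊕ Stk m T) (Dlt n r T) ℝ}
    (hΦ : S.IsResponse Φ) {K : Matrix (Stk m T) (Stk n T) ℝ} (hK : CausalGain K)
    (hKΦ : K * Φ.toRows₁ = Φ.toRows₂) (u : Fin (T + 1) → Fin m → ℝ) (w : Fin T → Fin r → ℝ) :
    S.ClosedLoop K u w ↔ stack u = Φ.toRows₂ *ᵥ Sum.elim S.x0 (stackDst w) := by
  set d := Sum.elim S.x0 (stackDst w) with hd
  have hdyn := hΦ.stackedDynamics d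
  have hKd : K *ᵥ (Φ.toRows₁ *ᵥ d) = Φ.toRows₂ *ᵥ d := by rw [Matrix.mulVec_mulVec, hKΦ]
  constructor
  · intro h
    have hst : S.StackedDynamics (stack (S.state u w)) (stack u) d :=
      (S.stackedDynamics_iff_state _ u w).mpr rfl
    rw [ClosedLoop] at h
    rw [h] at hst
    rw [← hKd] at hdyn
    set x := stack (S.state u w)
    -- Two closed-loop trajectories with the same `δ` differ by a fixed vector of a strictly lower
    -- triangular matrix.
    have hz : x - Φ.toRows₁ *ᵥ d = 0 := by
      refine eq_zero_of_eq_mulVec (b := Prod.snd)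
        (N := shift n T * S.calA + shift n T * (S.calB * K)) (fun p q hpq => ?_) ?_
      · rw [Matrix.add_apply, S.shift_calA_apply_eq_zero p q hpq,
          S.shift_calB_mul_apply_eq_zero hK p q hpq, add_zero]
      · rw [StackedDynamics] at hst hdyn
        conv_lhs => rw [hst, hdyn]
        rw [Matrix.add_mulVec, Matrix.mulVec_sub, Matrix.mulVec_sub, ← Matrix.mul_assoc,
          ← Matrix.mulVec_mulVec x _ K, ← Matrix.mulVec_mulVec (Φ.toRows₁ *ᵥ d) _ K]
        abel
    rw [h, sub_eq_zero.mp hz, hKd]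
  · intro h
    rw [ClosedLoop, h]
    rw [← h] at hdyn
    rw [← (S.stackedDynamics_iff_state _ u w).mp hdyn, hKd]

/-- Every causal feedback factors a response. -/
theorem exists_isResponse_of_causalGain {K : Matrix (Stk m T) (Stk n T) ℝ} (hK : CausalGain K) :
    ∃ Φ : Matrix (Stk n T ⊕ Stk m T) (Dlt n r T) ℝ, S.IsResponse Φ ∧
      K * Φ.toRows₁ = Φ.toRows₂ := by
  set N := shift n T * S.calA + shift n T * (S.calB * K) with hN
  have hNlow : ∀ p q : Stk n T, p.2 ≤ q.2 → N p q = 0 := fun p q hpq => by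
    rw [hN, Matrix.add_apply, S.shift_calA_apply_eq_zero p q hpq,
      S.shift_calB_mul_apply_eq_zero hK p q hpq, add_zero]
  have hu : IsUnit (1 - N) := isUnit_one_sub_of_strictLower (b := Prod.snd) hNlow
  have hdet := (Matrix.isUnit_iff_isUnit_det _).mp hu
  -- The closed-loop map from `δ` to the states.
  set X := (1 - N)⁻¹ * S.calE with hX
  have hXc : CausalMap X := fun p q hpq =>
    mul_apply_eq_zero_of_lower (a := Prod.snd) (b := Prod.snd) (c := Dlt.block)
      (inv_apply_eq_zero_of_lower hu (one_sub_apply_eq_zero_of_strictLower hNlow))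
      (fun p q hpq => S.calE_apply_eq_zero p q hpq.ne) p q hpq
  refine ⟨Matrix.fromRows X (K * X), isResponse_iff.mpr ⟨?_, ?_, ?_⟩, ?_⟩
  · simpa using hXc
  · rw [Matrix.toRows₂_fromRows]
    exact fun p q hpq => mul_apply_eq_zero_of_lower (a := Prod.snd) (b := Prod.snd)
      (c := Dlt.block) hK hXc p q hpq
  · rw [Matrix.toRows₁_fromRows, Matrix.toRows₂_fromRows]
    have h1 : (1 - N) * X = S.calE := by
      rw [hX, ← Matrix.mul_assoc, Matrix.mul_nonsing_inv _ hdet, Matrix.one_mul]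
    rw [Matrix.sub_mul, Matrix.one_mul, sub_eq_iff_eq_add] at h1
    conv_lhs => rw [h1, hN]
    simp only [Matrix.add_mul, Matrix.mul_assoc]
    abel
  · rw [Matrix.toRows₁_fromRows, Matrix.toRows₂_fromRows]

/-- The state response has a block lower triangular left inverse. -/
theorem IsResponse.exists_leftInverse {Φ : Matrix (Stk n T ⊕ Stk m T) (Dlt n r T) ℝ}
    (hΦ : S.IsResponse Φ)
    (hE : ∃ L : Matrix (Dlt n r T) (Stk n T) ℝ, L * S.calE = 1) :
    ∃ L : Matrix (Dlt n r T) (Stk n T) ℝ, L * Φ.toRows₁ = 1 ∧ CausalGain (Φ.toRows₂ * L) := by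
  obtain ⟨L, hL⟩ := hE
  obtain ⟨hx, hu, hdyn⟩ := isResponse_iff.mp hΦ
  -- `ℰ` is block diagonal, so the block diagonal part of a left inverse is again a left inverse,
  -- and this one is causal.
  set L₀ : Matrix (Dlt n r T) (Stk n T) ℝ :=
    Matrix.of fun p q => if Dlt.block p = q.2 then L p q else 0 with hL₀
  have hL₀E : L₀ * S.calE = 1 := by
    ext p q
    by_cases hpq : Dlt.block p = Dlt.block q
    · rw [← hL, Matrix.mul_apply, Matrix.mul_apply]
      refine Finset.sum_congr rfl fun s _ => ?_
      by_cases hs : s.2 = Dlt.block q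
      · simp [hL₀, hpq, hs]
      · rw [S.calE_apply_eq_zero s q hs, mul_zero, mul_zero]
    · rw [Matrix.one_apply_ne (fun h => hpq (congrArg _ h)), Matrix.mul_apply]
      refine Finset.sum_eq_zero fun s _ => ?_
      by_cases hs : s.2 = Dlt.block q
      · simp [hL₀, hs, hpq]
      · rw [S.calE_apply_eq_zero s q hs, mul_zero]
  have hL₀c : ∀ (p : Dlt n r T) (q : Stk n T), Dlt.block p < q.2 → L₀ p q = 0 := fun p q hpq => by
    simp [hL₀, hpq.ne]
  -- `Φ_x` is `ℰ` plus a strictly lower triangular part, so `L₀ Φ_x` is the identity up to a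
  -- strictly lower triangular matrix, hence invertible.
  set Y := shift n T * (S.calA * Φ.toRows₁ + S.calB * Φ.toRows₂) with hY
  have hYlow : ∀ p q, p.2 ≤ Dlt.block q → Y p q = 0 := by
    refine shift_mul_apply_eq_zero fun p q hpq => ?_
    have h1 := mul_apply_eq_zero_of_lower (a := Prod.snd) (b := Prod.snd) (c := Dlt.block)
      (M := S.calA) (blockDiagonal_apply_eq_zero _) hx p q hpq
    have h2 := mul_apply_eq_zero_of_lower (a := Prod.snd) (b := Prod.snd) (c := Dlt.block)
      (M := S.calB) (blockDiagonal_apply_eq_zero _) hu p q hpq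
    rw [Matrix.add_apply, h1, h2, add_zero]
  have hΦY : Φ.toRows₁ = Y + S.calE := by
    conv_lhs => rw [hdyn]
    rw [hY, Matrix.mul_add, Matrix.mul_assoc, Matrix.mul_assoc]
  set N := -(L₀ * Y) with hN
  have hNlow : ∀ p q, Dlt.block p ≤ Dlt.block q → N p q = 0 := by
    intro p q hpq
    rw [hN, Matrix.neg_apply, neg_eq_zero, Matrix.mul_apply]
    refine Finset.sum_eq_zero fun s _ => ?_
    rcases lt_or_ge (Dlt.block p) s.2 with h | h
    · rw [hL₀c p s h, zero_mul]
    · rw [hYlow s q (h.trans hpq), mul_zero]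
  have hunit : IsUnit (1 - N) := isUnit_one_sub_of_strictLower hNlow
  have hdet := (Matrix.isUnit_iff_isUnit_det _).mp hunit
  refine ⟨(1 - N)⁻¹ * L₀, ?_, ?_⟩
  · have : L₀ * Φ.toRows₁ = 1 - N := by
      rw [hΦY, Matrix.mul_add, hL₀E, hN, sub_neg_eq_add, add_comm]
    rw [Matrix.mul_assoc, this, Matrix.nonsing_inv_mul _ hdet]
  · have h1 := mul_apply_eq_zero_of_lower (a := Dlt.block) (b := Dlt.block) (c := Prod.snd)
      (inv_apply_eq_zero_of_lower hunit (one_sub_apply_eq_zero_of_strictLower hNlow)) hL₀c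
    exact fun p q hpq => mul_apply_eq_zero_of_lower (a := Prod.snd) (b := Dlt.block)
      (c := Prod.snd) hu h1 p q hpq

end Plant

/-! ### The regret as a quadratic form, and the matrix inequality as a bound on it -/

/-- The vector `(t, w)`. -/
def aug {r T : ℕ} (t : ℝ) (w : Fin T → Fin r → ℝ) : Unit ⊕ Dst r T → ℝ :=
  Sum.elim (fun _ => t) (stackDst w)

theorem exists_eq_aug {r T : ℕ} (y : Unit ⊕ Dst r T → ℝ) : ∃ t w, y = aug t w := by
  refine ⟨y (Sum.inl ()), unstack (fun p => y (Sum.inr p)), funext fun q => ?_⟩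
  rcases q with _ | _ <;> rfl

theorem dotProduct_blockDiagonal_mulVec {n k : ℕ} (M : Fin k → Matrix (Fin n) (Fin n) ℝ)
    (x : Fin n × Fin k → ℝ) :
    x ⬝ᵥ (Matrix.blockDiagonal M *ᵥ x) = ∑ j, unstack x j ⬝ᵥ (M j *ᵥ unstack x j) := by
  simp only [dotProduct, Fintype.sum_prod_type_right, blockDiagonal_mulVec_apply]
  rfl

theorem dotProduct_blockP_mulVec {r T : ℕ} (P : Matrix (Fin r) (Fin r) ℝ) (i : Fin T)
    (w : Fin T → Fin r → ℝ) :
    stackDst w ⬝ᵥ (blockP P i *ᵥ stackDst w) = w i ⬝ᵥ (P *ᵥ w i) := by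
  rw [blockP, dotProduct_blockDiagonal_mulVec, Finset.sum_eq_single i]
  · rw [Pi.single_eq_same]; rfl
  · intro j _ hj
    rw [Pi.single_eq_of_ne hj, Matrix.zero_mulVec, dotProduct_zero]
  · simp

theorem isHermitian_blockP {r T : ℕ} {P : Matrix (Fin r) (Fin r) ℝ} (hP : P.IsHermitian)
    (i : Fin T) : (blockP P i).IsHermitian := by
  rw [Matrix.IsHermitian, blockP, Matrix.blockDiagonal_conjTranspose]
  congr 1
  funext j
  rcases eq_or_ne j i with rfl | h
  · rw [Pi.single_eq_same]; exact hP.eq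
  · rw [Pi.single_eq_of_ne h, Matrix.conjTranspose_zero]

theorem posSemidef_sub_iff {ι : Type*} [Fintype ι] {A B : Matrix ι ι ℝ} (hA : A.IsHermitian)
    (hB : B.IsHermitian) :
    (A - B).PosSemidef ↔ ∀ y : ι → ℝ, y ⬝ᵥ (B *ᵥ y) ≤ y ⬝ᵥ (A *ᵥ y) := by
  rw [Matrix.posSemidef_iff_dotProduct_mulVec]
  simp only [star_trivial, Matrix.sub_mulVec, dotProduct_sub, sub_nonneg]
  exact ⟨fun h => h.2, fun h => ⟨hA.sub hB, h⟩⟩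

theorem dotProduct_transpose_mul_mul {ι κ : Type*} [Fintype ι] [Fintype κ] (M : Matrix κ κ ℝ)
    (N : Matrix κ ι ℝ) (y : ι → ℝ) :
    y ⬝ᵥ ((Nᵀ * M * N) *ᵥ y) = (N *ᵥ y) ⬝ᵥ (M *ᵥ (N *ᵥ y)) := by
  simpa using dotProduct_mul_mul_transpose Nᵀ M y

namespace Plant

variable {n m r T : ℕ} (S : Plant n m r T)

theorem posDef_calQ (hQ : ∀ k, (S.Q k).PosDef) : S.calQ.PosDef := posDef_blockDiagonal hQ

theorem posDef_calR (hR : ∀ k, (S.R k).PosDef) : S.calR.PosDef := posDef_blockDiagonal hR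

theorem posDef_calC (hQ : ∀ k, (S.Q k).PosDef) (hR : ∀ k, (S.R k).PosDef) : S.calC.PosDef := by
  refine Matrix.PosDef.of_dotProduct_mulVec_pos ?_ fun x hx => ?_
  · exact Matrix.IsHermitian.fromBlocks (S.posDef_calQ hQ).isHermitian (by simp)
      (S.posDef_calR hR).isHermitian
  · rw [star_trivial, calC, Matrix.fromBlocks_mulVec, ← Sum.elim_comp_inl_inr x]
    simp only [Matrix.zero_mulVec, add_zero, zero_add, Sum.elim_comp_inl, Sum.elim_comp_inr,
      sumElim_dotProduct_sumElim]
    have h1 := (S.posDef_calQ hQ).posSemidef.dotProduct_mulVec_nonneg (x ∘ Sum.inl)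
    have h2 := (S.posDef_calR hR).posSemidef.dotProduct_mulVec_nonneg (x ∘ Sum.inr)
    rw [star_trivial] at h1 h2
    by_cases hl : x ∘ Sum.inl = 0
    · have hr : x ∘ Sum.inr ≠ 0 := fun hr => hx (by
        rw [← Sum.elim_comp_inl_inr x, hl, hr]; exact Sum.elim_zero_zero)
      have := (S.posDef_calR hR).dotProduct_mulVec_pos hr
      rw [star_trivial] at this
      exact add_pos_of_nonneg_of_pos h1 this
    · have := (S.posDef_calQ hQ).dotProduct_mulVec_pos hl
      rw [star_trivial] at this
      exact add_pos_of_pos_of_nonneg this h2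

theorem dotProduct_calC_mulVec (x : Stk n T → ℝ) (u : Stk m T → ℝ) :
    Sum.elim x u ⬝ᵥ (S.calC *ᵥ Sum.elim x u) =
      x ⬝ᵥ (S.calQ *ᵥ x) + u ⬝ᵥ (S.calR *ᵥ u) := by
  rw [calC, Matrix.fromBlocks_mulVec]
  simp [sumElim_dotProduct_sumElim]

theorem cost_eq (u : Fin (T + 1) → Fin m → ℝ) (w : Fin T → Fin r → ℝ) :
    S.cost u w = stack (S.state u w) ⬝ᵥ (S.calQ *ᵥ stack (S.state u w)) +
      stack u ⬝ᵥ (S.calR *ᵥ stack u) := by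
  rw [calQ, calR, dotProduct_blockDiagonal_mulVec, dotProduct_blockDiagonal_mulVec, cost,
    Finset.sum_add_distrib]
  rfl

theorem dotProduct_calO_mulVec (d : Dlt n r T → ℝ) :
    d ⬝ᵥ (S.calO *ᵥ d) = (S.calG *ᵥ d) ⬝ᵥ
      ((S.calQ⁻¹ + S.calF * S.calR⁻¹ * S.calFᵀ)⁻¹ *ᵥ (S.calG *ᵥ d)) :=
  dotProduct_transpose_mul_mul _ _ _

variable {S}

theorem StackedDynamics.calO_le (hQ : ∀ k, (S.Q k).PosDef) (hR : ∀ k, (S.R k).PosDef)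
    {x : Stk n T → ℝ} {u : Stk m T → ℝ} {d : Dlt n r T → ℝ} (h : S.StackedDynamics x u d) :
    d ⬝ᵥ (S.calO *ᵥ d) ≤ x ⬝ᵥ (S.calQ *ᵥ x) + u ⬝ᵥ (S.calR *ᵥ u) := by
  rw [(S.stackedDynamics_iff x u d).mp h, dotProduct_calO_mulVec]
  exact le_add_form _ (S.posDef_calQ hQ) (S.posDef_calR hR) _ _

/-- After substituting `x = F u + G δ` this is the minimisation of a sum of two quadratic forms,
whose minimum is attained. -/
theorem optCost_eq (hQ : ∀ k, (S.Q k).PosDef) (hR : ∀ k, (S.R k).PosDef)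
    (w : Fin T → Fin r → ℝ) :
    S.optCost w = Sum.elim S.x0 (stackDst w) ⬝ᵥ (S.calO *ᵥ Sum.elim S.x0 (stackDst w)) := by
  have hle : ∀ u, Sum.elim S.x0 (stackDst w) ⬝ᵥ (S.calO *ᵥ Sum.elim S.x0 (stackDst w)) ≤
      S.cost u w := fun u => by
    rw [cost_eq]
    exact ((S.stackedDynamics_iff_state _ u w).mpr rfl).calO_le hQ hR
  refine le_antisymm ?_ (le_ciInf hle)
  obtain ⟨u, hu⟩ := exists_add_form_eq S.calF (S.posDef_calQ hQ) (S.posDef_calR hR)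
    (S.calG *ᵥ Sum.elim S.x0 (stackDst w))
  refine (ciInf_le ⟨_, Set.forall_mem_range.mpr hle⟩ (unstack u)).trans_eq ?_
  have hst := (S.stackedDynamics_iff_state _ (unstack u) w).mp
    ((S.stackedDynamics_iff _ _ _).mpr rfl)
  rw [cost_eq, ← hst, dotProduct_calO_mulVec, ← hu]
  rfl

theorem isHermitian_calO (hQ : ∀ k, (S.Q k).PosDef) (hR : ∀ k, (S.R k).PosDef) :
    S.calO.IsHermitian := by
  have := Matrix.isHermitian_conjTranspose_mul_mul S.calG
    (posDef_inv_add S.calF (S.posDef_calQ hQ) (S.posDef_calR hR)).inv.isHermitian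
  rwa [Matrix.conjTranspose_eq_transpose_of_trivial] at this

variable (S)

/-- The matrix of the map `(t, w) ↦ (t x₀, w)`. -/
def lift : Matrix (Dlt n r T) (Unit ⊕ Dst r T) ℝ :=
  Matrix.fromBlocks (Matrix.replicateCol Unit S.x0) 0 0 1

theorem lift_mulVec_aug (t : ℝ) (w : Fin T → Fin r → ℝ) :
    S.lift *ᵥ aug t w = Sum.elim (t • S.x0) (stackDst w) := by
  rw [lift, Matrix.fromBlocks_mulVec, aug]
  congr 1
  · funext i
    simp [Matrix.mulVec, dotProduct, mul_comm]
  · simp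

/-- The quadratic form of the dynamic regret in `(t, w)`, for the response `Ψ` to `(t x₀, w)`. -/
def regretForm (Ψ : Matrix (Stk n T ⊕ Stk m T) (Unit ⊕ Dst r T) ℝ) :
    Matrix (Unit ⊕ Dst r T) (Unit ⊕ Dst r T) ℝ :=
  Ψᵀ * S.calC * Ψ - S.liftᵀ * S.calO * S.lift

/-- The value of the quadratic form of the dynamic regret. -/
def regretAt (Ψ : Matrix (Stk n T ⊕ Stk m T) (Unit ⊕ Dst r T) ℝ) (t : ℝ)
    (w : Fin T → Fin r → ℝ) : ℝ :=
  aug t w ⬝ᵥ (S.regretForm Ψ *ᵥ aug t w)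

theorem regretAt_eq (Ψ : Matrix (Stk n T ⊕ Stk m T) (Unit ⊕ Dst r T) ℝ) (t : ℝ)
    (w : Fin T → Fin r → ℝ) :
    S.regretAt Ψ t w = (Ψ *ᵥ aug t w) ⬝ᵥ (S.calC *ᵥ (Ψ *ᵥ aug t w)) -
      Sum.elim (t • S.x0) (stackDst w) ⬝ᵥ (S.calO *ᵥ Sum.elim (t • S.x0) (stackDst w)) := by
  rw [regretAt, regretForm, Matrix.sub_mulVec, dotProduct_sub, dotProduct_transpose_mul_mul,
    dotProduct_transpose_mul_mul, lift_mulVec_aug]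

theorem mulVec_eq_sumElim (Φ : Matrix (Stk n T ⊕ Stk m T) (Dlt n r T) ℝ) (d : Dlt n r T → ℝ) :
    Φ *ᵥ d = Sum.elim (Φ.toRows₁ *ᵥ d) (Φ.toRows₂ *ᵥ d) := by
  funext p
  rcases p with _ | _ <;> rfl

variable {S}

theorem isHermitian_regretForm (hQ : ∀ k, (S.Q k).PosDef) (hR : ∀ k, (S.R k).PosDef)
    (Ψ : Matrix (Stk n T ⊕ Stk m T) (Unit ⊕ Dst r T) ℝ) : (S.regretForm Ψ).IsHermitian := by
  have h1 := Matrix.isHermitian_conjTranspose_mul_mul Ψ (S.posDef_calC hQ hR).isHermitian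
  have h2 := Matrix.isHermitian_conjTranspose_mul_mul S.lift (isHermitian_calO hQ hR)
  simpa [regretForm] using h1.sub h2

/-- The response to `(t x₀, w)` is a genuine trajectory from the initial state `t x₀`, so the
non-causal optimum bounds its cost from below for every `t`. -/
theorem IsResponse.regretAt_nonneg (hQ : ∀ k, (S.Q k).PosDef) (hR : ∀ k, (S.R k).PosDef)
    {Φ : Matrix (Stk n T ⊕ Stk m T) (Dlt n r T) ℝ} (hΦ : S.IsResponse Φ) (t : ℝ)
    (w : Fin T → Fin r → ℝ) : 0 ≤ S.regretAt (Φ * S.lift) t w := by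
  rw [regretAt_eq, ← Matrix.mulVec_mulVec, lift_mulVec_aug, mulVec_eq_sumElim,
    dotProduct_calC_mulVec, sub_nonneg]
  exact (hΦ.stackedDynamics _).calO_le hQ hR

theorem IsResponse.posSemidef_regretForm (hQ : ∀ k, (S.Q k).PosDef) (hR : ∀ k, (S.R k).PosDef)
    {Φ : Matrix (Stk n T ⊕ Stk m T) (Dlt n r T) ℝ} (hΦ : S.IsResponse Φ) :
    (S.regretForm (Φ * S.lift)).PosSemidef := by
  refine .of_dotProduct_mulVec_nonneg (isHermitian_regretForm hQ hR _) fun y => ?_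
  obtain ⟨t, w, rfl⟩ := exists_eq_aug y
  exact hΦ.regretAt_nonneg hQ hR t w

theorem IsResponse.cost_sub_optCost (hQ : ∀ k, (S.Q k).PosDef) (hR : ∀ k, (S.R k).PosDef)
    {Φ : Matrix (Stk n T ⊕ Stk m T) (Dlt n r T) ℝ} (hΦ : S.IsResponse Φ)
    {u : Fin (T + 1) → Fin m → ℝ} {w : Fin T → Fin r → ℝ}
    (hu : stack u = Φ.toRows₂ *ᵥ Sum.elim S.x0 (stackDst w)) :
    S.cost u w - S.optCost w = S.regretAt (Φ * S.lift) 1 w := by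
  have hdyn := hΦ.stackedDynamics (Sum.elim S.x0 (stackDst w))
  rw [← hu] at hdyn
  rw [regretAt_eq, ← Matrix.mulVec_mulVec, lift_mulVec_aug, mulVec_eq_sumElim,
    dotProduct_calC_mulVec, one_smul, optCost_eq hQ hR, cost_eq,
    ← (S.stackedDynamics_iff_state _ u w).mp hdyn, hu]

/-- The worst-case regret of a feedback in terms of a response that it factors. -/
theorem IsResponse.isWorstRegret_iff (hQ : ∀ k, (S.Q k).PosDef) (hR : ∀ k, (S.R k).PosDef)
    {Φ : Matrix (Stk n T ⊕ Stk m T) (Dlt n r T) ℝ} (hΦ : S.IsResponse Φ)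
    {K : Matrix (Stk m T) (Stk n T) ℝ} (hK : CausalGain K) (hKΦ : K * Φ.toRows₁ = Φ.toRows₂)
    (W : Set (Fin T → Fin r → ℝ)) (ρ : ℝ) :
    S.IsWorstRegret W K ρ ↔ IsGreatest ((fun w => S.regretAt (Φ * S.lift) 1 w) '' W) ρ := by
  rw [IsWorstRegret]
  convert! Iff.rfl using 2
  ext g
  constructor
  · rintro ⟨w, hw, rfl⟩
    have hu : stack (unstack (Φ.toRows₂ *ᵥ Sum.elim S.x0 (stackDst w))) =
      Φ.toRows₂ *ᵥ Sum.elim S.x0 (stackDst w) := rfl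
    exact ⟨w, hw, _, (hΦ.closedLoop_iff hK hKΦ _ w).mpr hu, (hΦ.cost_sub_optCost hQ hR hu).symm⟩
  · rintro ⟨w, hw, u, hu, rfl⟩
    exact ⟨w, hw, (hΦ.cost_sub_optCost hQ hR ((hΦ.closedLoop_iff hK hKΦ u w).mp hu)).symm⟩

theorem dotProduct_fromBlocks_mulVec_aug (a : ℝ) (N : Matrix (Dst r T) (Dst r T) ℝ) (t : ℝ)
    (w : Fin T → Fin r → ℝ) :
    aug t w ⬝ᵥ (Matrix.fromBlocks (Matrix.of fun (_ _ : Unit) => a) 0 0 N *ᵥ aug t w) =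
      a * t ^ 2 + stackDst w ⬝ᵥ (N *ᵥ stackDst w) := by
  rw [aug, Matrix.fromBlocks_mulVec]
  simp [Matrix.mulVec, dotProduct]
  ring

/-- The linear matrix inequality says that the regret is dominated by a diagonal form. -/
theorem posSemidef_lmi_iff (hQ : ∀ k, (S.Q k).PosDef) (hR : ∀ k, (S.R k).PosDef) (a : ℝ)
    {N : Matrix (Dst r T) (Dst r T) ℝ} (hN : N.IsHermitian)
    (Φ : Matrix (Stk n T ⊕ Stk m T) (Dlt n r T) ℝ) :
    (S.lmi a N Φ).PosSemidef ↔ ∀ t w, S.regretAt (Φ * S.lift) t w ≤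
      a * t ^ 2 + stackDst w ⬝ᵥ (N *ᵥ stackDst w) := by
  have hC := S.posDef_calC hQ hR
  have hCdet := (Matrix.isUnit_iff_isUnit_det _).mp hC.isUnit
  set D : Matrix (Unit ⊕ Dst r T) (Unit ⊕ Dst r T) ℝ :=
    Matrix.fromBlocks (Matrix.of fun _ _ => a) 0 0 N with hD
  have hDh : D.IsHermitian := Matrix.IsHermitian.fromBlocks (by ext; simp) (by simp) hN
  have hO12 : S.calO.toBlocks₁₂ = S.calO.toBlocks₂₁ᵀ := by
    ext i j
    exact ((isHermitian_calO hQ hR).apply (Sum.inl i) (Sum.inr j)).symm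
  have hlift : S.liftᵀ * S.calO * S.lift = Matrix.fromBlocks
      (Matrix.of fun _ _ => S.x0 ⬝ᵥ (S.calO.toBlocks₁₁ *ᵥ S.x0))
      (Matrix.replicateRow Unit (S.calO.toBlocks₂₁ *ᵥ S.x0))
      (Matrix.replicateCol Unit (S.calO.toBlocks₂₁ *ᵥ S.x0)) S.calO.toBlocks₂₂ := by
    conv_lhs => rw [← Matrix.fromBlocks_toBlocks S.calO]
    rw [lift, Matrix.fromBlocks_transpose, Matrix.fromBlocks_multiply, Matrix.fromBlocks_multiply]
    simp only [Matrix.transpose_zero, Matrix.transpose_one, Matrix.zero_mul, Matrix.mul_zero,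
      add_zero, zero_add, Matrix.one_mul, Matrix.mul_one]
    congr 1
    · ext i j
      rw [Matrix.of_apply, Matrix.dotProduct_mulVec]
      simp [Matrix.mul_apply, dotProduct, Matrix.vecMul]
    · ext i j
      rw [hO12]
      simp [Matrix.mul_apply, dotProduct, Matrix.mulVec, mul_comm]
  have hΦl : Φ * S.lift = Matrix.fromCols (Matrix.replicateCol Unit (Φ.toCols₁ *ᵥ S.x0))
      Φ.toCols₂ := by
    conv_lhs => rw [← Matrix.fromCols_toCols Φ]
    rw [lift, Matrix.fromCols_mul_fromBlocks]
    simp only [Matrix.mul_zero, add_zero, zero_add, Matrix.mul_one]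
    congr 1
  -- Regrouping the three blocks as `(t, w)` against the rest prepares the Schur complement with
  -- respect to `C⁻¹`.
  have hre : S.lmi a N Φ = (Matrix.fromBlocks (S.liftᵀ * S.calO * S.lift + D) (Φ * S.lift)ᵀ
      (Φ * S.lift)ᵀᴴ S.calC⁻¹).submatrix (Equiv.sumAssoc _ _ _).symm
        (Equiv.sumAssoc _ _ _).symm := by
    rw [hlift, hΦl, hD, lmi]
    ext i j
    rcases i with i | i | i <;> rcases j with j | j | j <;> simp [Matrix.fromBlocks]
  have := hC.inv.isUnit.invertible
  rw [hre, Matrix.posSemidef_submatrix_equiv, Matrix.PosDef.fromBlocks₂₂ _ _ hC.inv,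
    Matrix.nonsing_inv_nonsing_inv _ hCdet]
  have hform : S.liftᵀ * S.calO * S.lift + D - (Φ * S.lift)ᵀ * S.calC * (Φ * S.lift)ᵀᴴ =
      D - S.regretForm (Φ * S.lift) := by
    rw [regretForm, Matrix.conjTranspose_eq_transpose_of_trivial, Matrix.transpose_transpose]
    abel
  rw [hform, posSemidef_sub_iff hDh (isHermitian_regretForm hQ hR _)]
  constructor
  · intro h t w
    have := h (aug t w)
    rwa [hD, dotProduct_fromBlocks_mulVec_aug] at this
  · intro h y
    obtain ⟨t, w, rfl⟩ := exists_eq_aug y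
    rw [hD, dotProduct_fromBlocks_mulVec_aug]
    exact h t w

/-- The S-procedure form of feasibility: the last multiplier belongs to `t²`, and the one at
`k.castSucc` to the ellipsoid of `w k`. -/
theorem feasiblePWB_iff (hQ : ∀ k, (S.Q k).PosDef) (hR : ∀ k, (S.R k).PosDef)
    {P : Matrix (Fin r) (Fin r) ℝ} (hP : P.PosDef)
    (Φ : Matrix (Stk n T ⊕ Stk m T) (Dlt n r T) ℝ) (lam : Fin (T + 1) → ℝ) :
    S.FeasiblePWB P Φ lam ↔ (∀ i, 0 ≤ lam i) ∧ S.IsResponse Φ ∧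
      ∀ t w, S.regretAt (Φ * S.lift) t w ≤ lam (Fin.last T) * t ^ 2 +
        ∑ k : Fin T, lam k.castSucc * (w k ⬝ᵥ (P *ᵥ w k)) := by
  have hN : (∑ i : Fin T, lam i.castSucc • blockP P i).IsHermitian := by
    rw [Matrix.IsHermitian, Matrix.conjTranspose_sum]
    refine Finset.sum_congr rfl fun i _ => ?_
    rw [Matrix.conjTranspose_smul, star_trivial, (isHermitian_blockP hP.isHermitian i).eq]
  have hform : ∀ w : Fin T → Fin r → ℝ,
      stackDst w ⬝ᵥ ((∑ i : Fin T, lam i.castSucc • blockP P i) *ᵥ stackDst w) =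
        ∑ k : Fin T, lam k.castSucc * (w k ⬝ᵥ (P *ᵥ w k)) := by
    intro w
    rw [Matrix.sum_mulVec, dotProduct_sum]
    refine Finset.sum_congr rfl fun i _ => ?_
    rw [Matrix.smul_mulVec, dotProduct_smul, dotProduct_blockP_mulVec, smul_eq_mul]
  rw [FeasiblePWB, lmiPWB, posSemidef_lmi_iff hQ hR _ hN]
  simp only [hform]

theorem dotProduct_stackDst (w : Fin T → Fin r → ℝ) :
    stackDst w ⬝ᵥ stackDst w = ∑ k, w k ⬝ᵥ w k := by
  simp only [dotProduct, Fintype.sum_prod_type_right]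
  rfl

theorem feasibleEnergy_iff (hQ : ∀ k, (S.Q k).PosDef) (hR : ∀ k, (S.R k).PosDef) (ω : ℝ)
    (Φ : Matrix (Stk n T ⊕ Stk m T) (Dlt n r T) ℝ) (γ lam : ℝ) :
    S.FeasibleEnergy ω Φ γ lam ↔ 0 ≤ lam ∧ S.IsResponse Φ ∧
      ∀ t w, S.regretAt (Φ * S.lift) t w ≤ (γ - lam * ω) * t ^ 2 +
        lam * ∑ k, w k ⬝ᵥ w k := by
  have hN : (lam • (1 : Matrix (Dst r T) (Dst r T) ℝ)).IsHermitian := by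
    rw [Matrix.IsHermitian, Matrix.conjTranspose_smul, star_trivial, Matrix.conjTranspose_one]
  rw [FeasibleEnergy, posSemidef_lmi_iff hQ hR _ hN]
  simp only [Matrix.smul_mulVec, Matrix.one_mulVec, dotProduct_smul, dotProduct_stackDst,
    smul_eq_mul, neg_add_eq_sub]

/-- The linear matrix inequality for pointwise bounded disturbances is affine. -/
theorem exists_affineMap_eq_lmiPWB (P : Matrix (Fin r) (Fin r) ℝ) :
    ∃ f : (Matrix (Stk n T ⊕ Stk m T) (Dlt n r T) ℝ × (Fin (T + 1) → ℝ)) →ᵃ[ℝ]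
        Matrix (Unit ⊕ (Dst r T ⊕ (Stk n T ⊕ Stk m T)))
          (Unit ⊕ (Dst r T ⊕ (Stk n T ⊕ Stk m T))) ℝ,
      ∀ Φ lam, f (Φ, lam) = S.lmiPWB P Φ lam := by
  have hsum : ∀ (c : Fin T → ℝ) i j, (∑ k : Fin T, c k • blockP P k) i j =
      ∑ k : Fin T, c k * blockP P k i j := fun c i j => by
    rw [Matrix.sum_apply]; rfl
  -- The linear part is the increment from the value at zero.
  let L : (Matrix (Stk n T ⊕ Stk m T) (Dlt n r T) ℝ × (Fin (T + 1) → ℝ)) →ₗ[ℝ]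
      Matrix (Unit ⊕ (Dst r T ⊕ (Stk n T ⊕ Stk m T)))
        (Unit ⊕ (Dst r T ⊕ (Stk n T ⊕ Stk m T))) ℝ :=
    { toFun := fun p => S.lmiPWB P p.1 p.2 - S.lmiPWB P 0 0
      map_add' := fun p q => by
        ext i j
        rcases i with i | i | i <;> rcases j with j | j | j <;>
          simp [lmiPWB, lmi, Matrix.toCols₁, Matrix.toCols₂, Matrix.mulVec, dotProduct, hsum,
            add_mul, Finset.sum_add_distrib]
      map_smul' := fun c p => by
        ext i j
        rcases i with i | i | i <;> rcases j with j | j | j <;>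
          simp [lmiPWB, lmi, Matrix.toCols₁, Matrix.toCols₂, Matrix.mulVec, dotProduct, hsum,
            mul_assoc, Finset.mul_sum] }
  refine ⟨L.toAffineMap + AffineMap.const ℝ _ (S.lmiPWB P 0 0), fun Φ lam => ?_⟩
  change S.lmiPWB P Φ lam - S.lmiPWB P 0 0 + S.lmiPWB P 0 0 = _
  rw [sub_add_cancel]

end Plant

/-! ### Bounds for quadratic forms -/

section Bounds

variable {ι : Type*} [Fintype ι]

theorem sq_le_dotProduct_self (x : ι → ℝ) (i : ι) : x i ^ 2 ≤ x ⬝ᵥ x := by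
  rw [sq]
  exact Finset.single_le_sum (f := fun i => x i * x i) (fun j _ => mul_self_nonneg _)
    (Finset.mem_univ i)

theorem zero_le_dotProduct_self (x : ι → ℝ) : 0 ≤ x ⬝ᵥ x :=
  Finset.sum_nonneg fun _ _ => mul_self_nonneg _

theorem exists_dotProduct_mulVec_le (A : Matrix ι ι ℝ) :
    ∃ c, 0 < c ∧ ∀ x : ι → ℝ, x ⬝ᵥ (A *ᵥ x) ≤ c * (x ⬝ᵥ x) := by
  refine ⟨1 + ∑ i, ∑ j, |A i j|, by positivity, fun x => ?_⟩
  have h : x ⬝ᵥ (A *ᵥ x) ≤ (∑ i, ∑ j, |A i j|) * (x ⬝ᵥ x) := by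
    rw [dotProduct_mulVec_eq_sum, Finset.sum_mul]
    refine Finset.sum_le_sum fun i _ => ?_
    rw [Finset.sum_mul]
    refine Finset.sum_le_sum fun j _ => ?_
    have h1 : |x i * x j| ≤ x ⬝ᵥ x := by
      rw [abs_le]
      constructor <;>
        nlinarith [sq_le_dotProduct_self x i, sq_le_dotProduct_self x j, sq_nonneg (x i + x j),
          sq_nonneg (x i - x j)]
    calc A i j * (x i * x j) ≤ |A i j * (x i * x j)| := le_abs_self _
      _ = |A i j| * |x i * x j| := abs_mul _ _
      _ ≤ _ := mul_le_mul_of_nonneg_left h1 (abs_nonneg _)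
  linarith [zero_le_dotProduct_self x]

/-- Fenchel–Young at `p = x / c`, where `c` bounds the form of `A⁻¹` from above. -/
theorem exists_le_dotProduct_mulVec {A : Matrix ι ι ℝ} (hA : A.PosDef) :
    ∃ ε, 0 < ε ∧ ∀ x : ι → ℝ, ε * (x ⬝ᵥ x) ≤ x ⬝ᵥ (A *ᵥ x) := by
  classical
  obtain ⟨c, hc, h⟩ := exists_dotProduct_mulVec_le A⁻¹
  refine ⟨1 / c, by positivity, fun x => ?_⟩
  have h1 := two_mul_dotProduct_le hA x ((1 / c) • x)
  have h2 := h ((1 / c) • x)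
  simp only [smul_dotProduct, dotProduct_smul, smul_eq_mul] at h1 h2
  have h3 : c * (1 / c * (1 / c * (x ⬝ᵥ x))) = 1 / c * (x ⬝ᵥ x) := by field_simp
  linarith

/-- The gap is `s (1 - s)` times the form at `x - y`. -/
theorem dotProduct_mulVec_convex {H : Matrix ι ι ℝ} (hH : H.PosSemidef) (x y : ι → ℝ) {s : ℝ}
    (h0 : 0 ≤ s) (h1 : s ≤ 1) :
    (s • x + (1 - s) • y) ⬝ᵥ (H *ᵥ (s • x + (1 - s) • y)) ≤
      s * (x ⬝ᵥ (H *ᵥ x)) + (1 - s) * (y ⬝ᵥ (H *ᵥ y)) := by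
  have h := hH.dotProduct_mulVec_nonneg (x - y)
  rw [star_trivial, Matrix.mulVec_sub, sub_dotProduct, dotProduct_sub, dotProduct_sub] at h
  simp only [Matrix.mulVec_add, Matrix.mulVec_smul, add_dotProduct, dotProduct_add,
    smul_dotProduct, dotProduct_smul, smul_eq_mul]
  have := mul_nonneg (mul_nonneg h0 (sub_nonneg.mpr h1)) h
  linarith

open scoped MatrixOrder in
theorem exists_eq_dotProduct_self_of_posDef [DecidableEq ι] {A : Matrix ι ι ℝ} (hA : A.PosDef) :
    ∃ B : Matrix ι ι ℝ, B⁻¹ * B = 1 ∧ B * B⁻¹ = 1 ∧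
      ∀ x, x ⬝ᵥ (A *ᵥ x) = (B *ᵥ x) ⬝ᵥ (B *ᵥ x) := by
  obtain ⟨B, hB⟩ := CStarAlgebra.nonneg_iff_eq_star_mul_self.mp hA.posSemidef.nonneg
  rw [Matrix.star_eq_conjTranspose, Matrix.conjTranspose_eq_transpose_of_trivial] at hB
  have hdet : IsUnit B.det := by
    have := (Matrix.isUnit_iff_isUnit_det _).mp hA.isUnit
    rw [hB, Matrix.det_mul] at this
    exact isUnit_of_mul_isUnit_right this
  refine ⟨B, Matrix.nonsing_inv_mul _ hdet, Matrix.mul_nonsing_inv _ hdet, fun x => ?_⟩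
  have := dotProduct_transpose_mul_mul (1 : Matrix ι ι ℝ) B x
  rwa [Matrix.mul_one, ← hB, Matrix.one_mulVec] at this

theorem exists_isLeast_image {X : Type*} [TopologicalSpace X] {F C : Set X} (hF : IsClosed F)
    {g : X → ℝ} (hg : Continuous g) {a : X} (ha : a ∈ F) (hC : IsCompact C)
    (hsub : ∀ x ∈ F, g x ≤ g a → x ∈ C) : ∃ v, IsLeast (g '' F) v := by
  have hK : IsCompact (C ∩ F) := hC.inter_right hF
  obtain ⟨x, hx, hmin⟩ := hK.exists_isMinOn ⟨a, hsub a ha le_rfl, ha⟩ hg.continuousOn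
  refine ⟨g x, ⟨x, hx.2, rfl⟩, ?_⟩
  rintro _ ⟨y, hy, rfl⟩
  rcases le_or_gt (g y) (g a) with h | h
  · exact hmin ⟨hsub y hy h, hy⟩
  · exact (hmin ⟨hsub a ha le_rfl, ha⟩).trans h.le

end Bounds

/-! ### Products of ellipsoids -/

section Ellipsoids

variable {r T : ℕ} {P : Matrix (Fin r) (Fin r) ℝ}

theorem isCompact_ellipsoid (hP : P.PosDef) :
    IsCompact {w : Fin r → ℝ | w ⬝ᵥ (P *ᵥ w) ≤ 1} := by
  obtain ⟨ε, hε, h⟩ := exists_le_dotProduct_mulVec hP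
  refine IsCompact.of_isClosed_subset (isCompact_univ_pi fun _ : Fin r =>
    isCompact_Icc (a := -(1 + 1 / ε)) (b := 1 + 1 / ε)) ?_ fun w hw j _ => ?_
  · exact isClosed_le (continuous_id.dotProduct (continuous_const.matrix_mulVec continuous_id))
      continuous_const
  · have h1 : w j ^ 2 ≤ 1 / ε := by
      rw [le_div_iff₀ hε]
      have hw' : w ⬝ᵥ (P *ᵥ w) ≤ 1 := hw
      nlinarith [h w, sq_le_dotProduct_self w j]
    have h2 : 0 < 1 / ε := by positivity
    exact ⟨by nlinarith, by nlinarith⟩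

theorem isCompact_ellipsoids (hP : P.PosDef) : IsCompact (ellipsoids T P) := by
  have : ellipsoids T P =
      Set.pi Set.univ fun _ : Fin T => {w : Fin r → ℝ | w ⬝ᵥ (P *ᵥ w) ≤ 1} := by
    ext w
    simp [ellipsoids]
  rw [this]
  exact isCompact_univ_pi fun _ => isCompact_ellipsoid hP

theorem zero_mem_ellipsoids : (0 : Fin T → Fin r → ℝ) ∈ ellipsoids T P := fun k => by
  simp

/-- These disturbances probe the columns of a response one by one. -/
theorem exists_single_mem_ellipsoids (P : Matrix (Fin r) (Fin r) ℝ) :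
    ∃ s : ℝ, 0 < s ∧ ∀ (k : Fin T) (j : Fin r),
      (Pi.single k (Pi.single j s) : Fin T → Fin r → ℝ) ∈ ellipsoids T P := by
  obtain ⟨c, hc, h⟩ := exists_dotProduct_mulVec_le P
  refine ⟨(Real.sqrt c)⁻¹, by positivity, fun k j l => ?_⟩
  rcases eq_or_ne l k with rfl | hl
  · rw [Pi.single_eq_same]
    refine (h _).trans ?_
    rw [single_dotProduct, Pi.single_eq_same, ← mul_inv, Real.mul_self_sqrt hc.le,
      mul_inv_cancel₀ hc.ne']
  · rw [Pi.single_eq_of_ne hl]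
    simp

/-- The largest squared norm on an ellipsoid. -/
theorem exists_dotProduct_self_le (hP : P.PosDef) :
    ∃ μ : ℝ, 0 ≤ μ ∧ (∀ w : Fin r → ℝ, w ⬝ᵥ w ≤ μ * (w ⬝ᵥ (P *ᵥ w))) ∧
      ∃ w : Fin r → ℝ, w ⬝ᵥ (P *ᵥ w) ≤ 1 ∧ w ⬝ᵥ w = μ := by
  obtain ⟨w₀, hw₀, hmax⟩ := (isCompact_ellipsoid hP).exists_isMaxOn ⟨0, by simp⟩
    (f := fun w : Fin r → ℝ => w ⬝ᵥ w) (continuous_id.dotProduct continuous_id).continuousOn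
  refine ⟨w₀ ⬝ᵥ w₀, zero_le_dotProduct_self _, fun w => ?_, w₀, hw₀, rfl⟩
  rcases eq_or_ne w 0 with rfl | hw
  · simp
  have hpos := hP.dotProduct_mulVec_pos hw
  rw [star_trivial] at hpos
  set q := w ⬝ᵥ (P *ᵥ w) with hq
  have hs : Real.sqrt q * Real.sqrt q = q := Real.mul_self_sqrt hpos.le
  have hinv : (Real.sqrt q)⁻¹ * (Real.sqrt q)⁻¹ = q⁻¹ := by rw [← mul_inv, hs]
  have h1 : ((Real.sqrt q)⁻¹ • w) ∈ {w : Fin r → ℝ | w ⬝ᵥ (P *ᵥ w) ≤ 1} := by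
    change ((Real.sqrt q)⁻¹ • w) ⬝ᵥ (P *ᵥ ((Real.sqrt q)⁻¹ • w)) ≤ 1
    rw [Matrix.mulVec_smul, smul_dotProduct, dotProduct_smul, smul_eq_mul, smul_eq_mul, ← mul_assoc,
      hinv, ← hq, inv_mul_cancel₀ hpos.ne']
  have h2 : ((Real.sqrt q)⁻¹ • w) ⬝ᵥ ((Real.sqrt q)⁻¹ • w) ≤ w₀ ⬝ᵥ w₀ := hmax h1
  rw [smul_dotProduct, dotProduct_smul, smul_eq_mul, smul_eq_mul, ← mul_assoc, hinv,
    inv_mul_le_iff₀ hpos] at h2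
  linarith

end Ellipsoids

namespace Plant

variable {n m r T : ℕ} (S : Plant n m r T)

/-! ### The responses that a trajectory can see -/

/-- The differences of causal system responses. -/
def responseDirections : Submodule ℝ (Matrix (Stk n T ⊕ Stk m T) (Dlt n r T) ℝ) where
  carrier := {Φ | CausalMap Φ.toRows₁ ∧ CausalMap Φ.toRows₂ ∧
    Matrix.fromCols (1 - shift n T * S.calA) (-(shift n T * S.calB)) * Φ = 0}
  add_mem' := by
    rintro Φ Θ ⟨h1, h2, h3⟩ ⟨h4, h5, h6⟩
    refine ⟨fun p q h => ?_, fun p q h => ?_, by rw [Matrix.mul_add, h3, h6, add_zero]⟩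
    · exact (congrArg₂ (· + ·) (h1 p q h) (h4 p q h)).trans (add_zero 0)
    · exact (congrArg₂ (· + ·) (h2 p q h) (h5 p q h)).trans (add_zero 0)
  zero_mem' := ⟨fun _ _ _ => rfl, fun _ _ _ => rfl, Matrix.mul_zero _⟩
  smul_mem' := by
    rintro c Φ ⟨h1, h2, h3⟩
    refine ⟨fun p q h => ?_, fun p q h => ?_, by rw [Matrix.mul_smul, h3, smul_zero]⟩
    · exact (congrArg (c * ·) (h1 p q h)).trans (mul_zero c)
    · exact (congrArg (c * ·) (h2 p q h)).trans (mul_zero c)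

/-- The responses to `(t, w)` that come from causal system responses. -/
def liftedResponses : Set (Matrix (Stk n T ⊕ Stk m T) (Unit ⊕ Dst r T) ℝ) :=
  {Ψ | ∃ Φ, S.IsResponse Φ ∧ Φ * S.lift = Ψ}

theorem exists_isResponse : ∃ Φ : Matrix (Stk n T ⊕ Stk m T) (Dlt n r T) ℝ, S.IsResponse Φ := by
  obtain ⟨Φ, hΦ, -⟩ := exists_isResponse_of_causalGain (S := S) (K := 0) fun _ _ _ => rfl
  exact ⟨Φ, hΦ⟩

/-- A translate of the linear image of a subspace, in finite dimension. The image matters: the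
responses themselves are not controlled in directions that annihilate `x₀`. -/
theorem isClosed_liftedResponses : IsClosed S.liftedResponses := by
  obtain ⟨Φ₀, h1, h2, h3⟩ := S.exists_isResponse
  have hset : S.liftedResponses = (fun Ψ => Ψ - Φ₀ * S.lift) ⁻¹'
      (S.responseDirections.map (mulRightLinearMap (Stk n T ⊕ Stk m T) ℝ S.lift) :
        Set (Matrix (Stk n T ⊕ Stk m T) (Unit ⊕ Dst r T) ℝ)) := by
    ext Ψ
    constructor
    · rintro ⟨Φ, ⟨h4, h5, h6⟩, rfl⟩
      refine ⟨Φ - Φ₀, ⟨fun p q h => ?_, fun p q h => ?_, ?_⟩, ?_⟩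
      · exact (congrArg₂ (· - ·) (h4 p q h) (h1 p q h)).trans (sub_zero 0)
      · exact (congrArg₂ (· - ·) (h5 p q h) (h2 p q h)).trans (sub_zero 0)
      · rw [Matrix.mul_sub, h6, h3, sub_self]
      · exact Matrix.sub_mul _ _ _
    · rintro ⟨Θ, ⟨h4, h5, h6⟩, h7⟩
      refine ⟨Θ + Φ₀, ⟨fun p q h => ?_, fun p q h => ?_, ?_⟩, ?_⟩
      · exact (congrArg₂ (· + ·) (h4 p q h) (h1 p q h)).trans (add_zero 0)
      · exact (congrArg₂ (· + ·) (h5 p q h) (h2 p q h)).trans (add_zero 0)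
      · rw [Matrix.mul_add, h6, h3, zero_add]
      · rw [Matrix.add_mul]
        exact eq_sub_iff_add_eq.mp h7
  rw [hset]
  exact (Submodule.closed_of_finiteDimensional _).preimage (continuous_id.sub continuous_const)

theorem continuous_regretAt_left (t : ℝ) (w : Fin T → Fin r → ℝ) :
    Continuous fun Ψ => S.regretAt Ψ t w := by
  simp only [regretAt_eq]
  have h : Continuous fun Ψ : Matrix (Stk n T ⊕ Stk m T) (Unit ⊕ Dst r T) ℝ => Ψ *ᵥ aug t w :=
    continuous_id.matrix_mulVec continuous_const
  exact (h.dotProduct (continuous_const.matrix_mulVec h)).sub continuous_const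

theorem continuous_regretAt_right (Ψ : Matrix (Stk n T ⊕ Stk m T) (Unit ⊕ Dst r T) ℝ) (t : ℝ) :
    Continuous fun w => S.regretAt Ψ t w := by
  have h : Continuous fun w : Fin T → Fin r → ℝ => aug t w := by
    refine continuous_pi fun q => ?_
    rcases q with _ | q
    · exact continuous_const
    · exact (continuous_apply q.1).comp (continuous_apply q.2)
  exact h.dotProduct (continuous_const.matrix_mulVec h)

variable {S}

/-- Responses with bounded regret lie in a compact box. -/
theorem exists_isCompact_of_regretAt_le (hQ : ∀ k, (S.Q k).PosDef) (hR : ∀ k, (S.R k).PosDef)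
    {P : Matrix (Fin r) (Fin r) ℝ} {ω : ℝ}
    (hω : ∀ w ∈ ellipsoids T P, ∑ k, w k ⬝ᵥ w k ≤ ω) (c : ℝ) :
    ∃ B : Set (Matrix (Stk n T ⊕ Stk m T) (Unit ⊕ Dst r T) ℝ), IsCompact B ∧
      ∀ Ψ, (∀ w ∈ ellipsoids T P, S.regretAt Ψ 1 w ≤ c) → Ψ ∈ B := by
  obtain ⟨ε, hε, hC⟩ := exists_le_dotProduct_mulVec (S.posDef_calC hQ hR)
  obtain ⟨a, ha, hO⟩ := exists_dotProduct_mulVec_le S.calO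
  obtain ⟨s, hs, hsW⟩ := exists_single_mem_ellipsoids (T := T) P
  -- The cost is the regret plus the non-causal cost; coercivity of `C` turns its bound into one on
  -- the squared output.
  set b := (c + a * (S.x0 ⬝ᵥ S.x0 + ω)) / ε with hb
  have hbound : ∀ Ψ : Matrix (Stk n T ⊕ Stk m T) (Unit ⊕ Dst r T) ℝ,
      (∀ w ∈ ellipsoids T P, S.regretAt Ψ 1 w ≤ c) → ∀ w ∈ ellipsoids T P, ∀ p,
        |(Ψ *ᵥ aug 1 w) p| ≤ 1 + b := by
    intro Ψ hΨ w hw p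
    have h1 := hΨ w hw
    rw [regretAt_eq, one_smul] at h1
    have h2 := hC (Ψ *ᵥ aug 1 w)
    have h3 := hO (Sum.elim S.x0 (stackDst w))
    rw [sumElim_dotProduct_sumElim, dotProduct_stackDst] at h3
    have h4 := mul_le_mul_of_nonneg_left (hω w hw) ha.le
    have h5 : (Ψ *ᵥ aug 1 w) ⬝ᵥ (Ψ *ᵥ aug 1 w) ≤ b := by
      rw [hb, le_div_iff₀ hε]
      linarith
    have h6 := (sq_le_dotProduct_self (Ψ *ᵥ aug 1 w) p).trans h5
    rw [abs_le]
    constructor <;> nlinarith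
  -- The zero disturbance bounds the first column; the outputs at zero and at a single entry `s`
  -- differ by `s` times another column.
  set M := 1 + b + (2 * (1 + b)) / s with hM
  refine ⟨Set.pi Set.univ fun _ => Set.pi Set.univ fun _ => Set.Icc (-M) M,
    isCompact_univ_pi fun _ => isCompact_univ_pi fun _ => isCompact_Icc, fun Ψ hΨ p _ q _ => ?_⟩
  have h0 : |Ψ p (Sum.inl ())| ≤ 1 + b := by
    have := hbound Ψ hΨ 0 zero_mem_ellipsoids p
    have e : (Ψ *ᵥ aug 1 (0 : Fin T → Fin r → ℝ)) p = Ψ p (Sum.inl ()) := by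
      simp [Matrix.mulVec, dotProduct, aug, stackDst]
    rwa [e] at this
  have hb0 : 0 ≤ 1 + b := (abs_nonneg _).trans h0
  have hdiv : 0 ≤ 2 * (1 + b) / s := by positivity
  rw [Set.mem_Icc, ← abs_le]
  rcases q with ⟨⟩ | ⟨j, k⟩
  · exact h0.trans (by linarith)
  · have := hbound Ψ hΨ _ (hsW k j) p
    have e : (Ψ *ᵥ aug 1 (Pi.single k (Pi.single j s))) p =
        Ψ p (Sum.inl ()) + Ψ p (Sum.inr (j, k)) * s := by
      rw [Matrix.mulVec, dotProduct, Fintype.sum_sum_type]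
      congr 1
      · simp [aug]
      · rw [Finset.sum_eq_single (j, k)]
        · simp [aug, stackDst]
        · rintro ⟨j', k'⟩ - h
          by_cases hk : k' = k
          · subst hk
            have hj : j' ≠ j := fun hj => h (by rw [hj])
            simp [aug, stackDst, hj]
          · simp [aug, stackDst, hk]
        · simp
    rw [e] at this
    have h1 : |Ψ p (Sum.inr (j, k))| * s ≤ 2 * (1 + b) := by
      calc |Ψ p (Sum.inr (j, k))| * s
          = |Ψ p (Sum.inr (j, k)) * s| := by rw [abs_mul, abs_of_pos hs]
        _ = |(Ψ p (Sum.inl ()) + Ψ p (Sum.inr (j, k)) * s) - Ψ p (Sum.inl ())| := by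
            rw [add_sub_cancel_left]
        _ ≤ _ := (abs_sub _ _).trans (by linarith)
    have h2 := (le_div_iff₀ hs).mpr h1
    linarith

/-! ### Relations between the three programs -/

section Programs

variable {P : Matrix (Fin r) (Fin r) ℝ}

theorem FeasiblePWB.regretAt_le (hQ : ∀ k, (S.Q k).PosDef) (hR : ∀ k, (S.R k).PosDef)
    (hP : P.PosDef) {Φ : Matrix (Stk n T ⊕ Stk m T) (Dlt n r T) ℝ} {lam : Fin (T + 1) → ℝ}
    (h : S.FeasiblePWB P Φ lam) {w : Fin T → Fin r → ℝ} (hw : w ∈ ellipsoids T P) :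
    S.regretAt (Φ * S.lift) 1 w ≤ ∑ i, lam i := by
  obtain ⟨h0, -, h1⟩ := (feasiblePWB_iff hQ hR hP Φ lam).mp h
  refine (h1 1 w).trans ?_
  rw [Fin.sum_univ_castSucc, one_pow, mul_one, add_comm]
  refine add_le_add_left (Finset.sum_le_sum fun k _ => ?_) _
  exact mul_le_of_le_one_right (h0 _) (hw k)

theorem FeasibleEnergy.regretAt_le (hQ : ∀ k, (S.Q k).PosDef) (hR : ∀ k, (S.R k).PosDef)
    {ω : ℝ} (hω : ∀ w ∈ ellipsoids T P, ∑ k, w k ⬝ᵥ w k ≤ ω)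
    {Φ : Matrix (Stk n T ⊕ Stk m T) (Dlt n r T) ℝ} {γ lam : ℝ}
    (h : S.FeasibleEnergy ω Φ γ lam) {w : Fin T → Fin r → ℝ} (hw : w ∈ ellipsoids T P) :
    S.regretAt (Φ * S.lift) 1 w ≤ γ := by
  obtain ⟨h0, -, h1⟩ := (feasibleEnergy_iff hQ hR ω Φ γ lam).mp h
  have h2 := h1 1 w
  have h3 := mul_le_mul_of_nonneg_left (hω w hw) h0
  rw [one_pow, mul_one] at h2
  linarith

/-- Evaluate at `t = 1`, `w = 0`, where the regret is nonnegative. -/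
theorem FeasibleEnergy.mul_le (hQ : ∀ k, (S.Q k).PosDef) (hR : ∀ k, (S.R k).PosDef)
    {ω : ℝ} {Φ : Matrix (Stk n T ⊕ Stk m T) (Dlt n r T) ℝ} {γ lam : ℝ}
    (h : S.FeasibleEnergy ω Φ γ lam) : lam * ω ≤ γ := by
  obtain ⟨-, hΦ, h1⟩ := (feasibleEnergy_iff hQ hR ω Φ γ lam).mp h
  have h2 := (hΦ.regretAt_nonneg hQ hR 1 0).trans (h1 1 0)
  simp at h2
  linarith

/-- A bound on the energy program gives one on the pointwise program. -/
theorem FeasibleEnergy.exists_feasiblePWB (hQ : ∀ k, (S.Q k).PosDef)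
    (hR : ∀ k, (S.R k).PosDef) (hP : P.PosDef) {ω : ℝ}
    (hω : ∀ w ∈ ellipsoids T P, ∑ k, w k ⬝ᵥ w k ≤ ω)
    {Φ : Matrix (Stk n T ⊕ Stk m T) (Dlt n r T) ℝ} {γ lam : ℝ}
    (h : S.FeasibleEnergy ω Φ γ lam) :
    ∃ lam' : Fin (T + 1) → ℝ, S.FeasiblePWB P Φ lam' ∧ ∑ i, lam' i ≤ γ := by
  obtain ⟨h0, hΦ, h1⟩ := (feasibleEnergy_iff hQ hR ω Φ γ lam).mp h
  obtain ⟨μ, hμ0, hμ, w₀, hw₀, hw₀μ⟩ := exists_dotProduct_self_le hP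
  -- The worst vector can be repeated at every time.
  have hTμ : (T : ℝ) * μ ≤ ω := by
    have := hω (fun _ => w₀) fun _ => hw₀
    simpa [hw₀μ] using this
  have hγ := h.mul_le hQ hR
  -- The sum is `γ - λ ω + T λ μ`, at most `γ`; `FeasibleEnergy.mul_le` makes the last multiplier
  -- nonnegative.
  refine ⟨Fin.snoc (α := fun _ => ℝ) (fun _ => lam * μ) (γ - lam * ω),
    (feasiblePWB_iff hQ hR hP _ _).mpr ⟨fun i => ?_, hΦ, fun t w => ?_⟩, ?_⟩
  · induction i using Fin.lastCases with
    | last => rw [Fin.snoc_last]; linarith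
    | cast i => rw [Fin.snoc_castSucc]; positivity
  · refine (h1 t w).trans ?_
    simp only [Fin.snoc_last, Fin.snoc_castSucc]
    rw [Finset.mul_sum]
    refine add_le_add_right (Finset.sum_le_sum fun k _ => ?_) _
    rw [mul_assoc]
    exact mul_le_mul_of_nonneg_left (hμ _) h0
  · rw [Fin.sum_univ_castSucc]
    simp only [Fin.snoc_last, Fin.snoc_castSucc, Finset.sum_const, Finset.card_univ,
      Fintype.card_fin, nsmul_eq_mul]
    have := mul_le_mul_of_nonneg_left hTμ h0
    linarith

theorem aug_neg_one (w : Fin T → Fin r → ℝ) : aug (-1) w = -aug 1 (-w) := by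
  funext q
  rcases q with _ | _ <;> simp [aug, stackDst]

/-- On a symmetric set, a bound on the regret extends to initial states `t x₀`, `|t| ≤ 1`. -/
theorem IsResponse.regretAt_le_of_sq_le_one (hQ : ∀ k, (S.Q k).PosDef)
    (hR : ∀ k, (S.R k).PosDef) {Φ : Matrix (Stk n T ⊕ Stk m T) (Dlt n r T) ℝ}
    (hΦ : S.IsResponse Φ) {v : ℝ}
    (hv : ∀ w ∈ ellipsoids T P, S.regretAt (Φ * S.lift) 1 w ≤ v) {t : ℝ} (ht : t ^ 2 ≤ 1)
    {w : Fin T → Fin r → ℝ} (hw : w ∈ ellipsoids T P) : S.regretAt (Φ * S.lift) t w ≤ v := by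
  have h1 := hv w hw
  have h2 := hv (-w) fun k => by
    simpa [Matrix.mulVec_neg] using hw k
  have h3 : S.regretAt (Φ * S.lift) (-1) w = S.regretAt (Φ * S.lift) 1 (-w) := by
    rw [regretAt, aug_neg_one, Matrix.mulVec_neg, neg_dotProduct_neg, regretAt]
  have hl : -1 ≤ t := by nlinarith
  have hu : t ≤ 1 := by nlinarith
  have hs0 : 0 ≤ (1 + t) / 2 := by linarith
  have hs1 : (1 + t) / 2 ≤ 1 := by linarith
  -- `(t, w)` is a convex combination of `(1, w)` and `(-1, w)`, and the latter is the negative of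
  -- `(1, -w)`.
  have h4 := dotProduct_mulVec_convex (hΦ.posSemidef_regretForm hQ hR) (aug 1 w) (aug (-1) w)
    hs0 hs1
  have e : ((1 + t) / 2) • aug 1 w + (1 - (1 + t) / 2) • aug (-1) w = aug t w := by
    funext q
    rcases q with _ | q
    · simp [aug]; ring
    · simp only [aug, Pi.add_apply, Pi.smul_apply, smul_eq_mul, Sum.elim_inr]; ring
  rw [e] at h4
  have h5 : S.regretAt (Φ * S.lift) t w ≤ (1 + t) / 2 * S.regretAt (Φ * S.lift) 1 w +
      (1 - (1 + t) / 2) * S.regretAt (Φ * S.lift) (-1) w := h4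
  rw [h3] at h5
  nlinarith

/-- A bound on the worst-case regret of a response is certified by multipliers, up to the factor
`π / 2`. -/
theorem IsResponse.exists_feasiblePWB (hQ : ∀ k, (S.Q k).PosDef) (hR : ∀ k, (S.R k).PosDef)
    (hP : P.PosDef) {Φ : Matrix (Stk n T ⊕ Stk m T) (Dlt n r T) ℝ} (hΦ : S.IsResponse Φ) {v : ℝ}
    (hv : ∀ w ∈ ellipsoids T P, S.regretAt (Φ * S.lift) 1 w ≤ v) :
    ∃ lam : Fin (T + 1) → ℝ, S.FeasiblePWB P Φ lam ∧ ∑ i, lam i ≤ Real.pi / 2 * v := by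
  obtain ⟨B, hB1, hB2, hB⟩ := exists_eq_dotProduct_self_of_posDef hP
  -- In the coordinates `y = B w`, with `P = Bᵀ B`, the ellipsoids are unit balls.
  set D : Matrix (Unit ⊕ Dst r T) (Unit ⊕ Dst r T) ℝ :=
    Matrix.fromBlocks 1 0 0 (Matrix.blockDiagonal fun _ => B⁻¹) with hD
  have hDaug : ∀ (t : ℝ) (w : Fin T → Fin r → ℝ), D *ᵥ aug t w = aug t fun k => B⁻¹ *ᵥ w k := by
    intro t w
    rw [hD, aug, Matrix.fromBlocks_mulVec]
    simp only [Sum.elim_comp_inl, Sum.elim_comp_inr, Matrix.one_mulVec, Matrix.zero_mulVec,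
      add_zero, zero_add]
    rw [aug]
    congr 1
    funext p
    exact blockDiagonal_mulVec_apply _ _ _ _
  have hform : ∀ (t : ℝ) (w : Fin T → Fin r → ℝ),
      aug t w ⬝ᵥ ((Dᵀ * S.regretForm (Φ * S.lift) * D) *ᵥ aug t w) =
        S.regretAt (Φ * S.lift) t fun k => B⁻¹ *ᵥ w k := by
    intro t w
    rw [dotProduct_transpose_mul_mul, hDaug, regretAt]
  have hH : (Dᵀ * S.regretForm (Φ * S.lift) * D).PosSemidef := by
    simpa using (hΦ.posSemidef_regretForm hQ hR).conjTranspose_mul_mul_same D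
  -- The scalar `t` is a ball of its own, numbered last to match its multiplier.
  set b : Unit ⊕ Dst r T → Fin (T + 1) :=
    Sum.elim (fun _ => Fin.last T) (fun p => p.2.castSucc) with hb
  obtain ⟨lam, h0, h1, h2⟩ := exists_multipliers hH b v fun x hx => by
      obtain ⟨t, y, rfl⟩ := exists_eq_aug x
      rw [hform]
      refine hΦ.regretAt_le_of_sq_le_one hQ hR hv ?_ fun k => ?_
      · refine le_trans ?_ (hx (Fin.last T))
        exact Finset.single_le_sum (s := {i | b i = Fin.last T}) (f := fun i => aug t y i ^ 2)
          (fun _ _ => sq_nonneg _)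
          (Finset.mem_filter.mpr ⟨Finset.mem_univ (Sum.inl ()), rfl⟩)
      · rw [hB, Matrix.mulVec_mulVec, hB2, Matrix.one_mulVec]
        refine le_trans (le_of_eq ?_) (hx k.castSucc)
        rw [Finset.sum_filter, Fintype.sum_sum_type, Fintype.sum_prod_type_right,
          Finset.sum_eq_single k]
        · simp [hb, aug, stackDst, dotProduct, sq, (Fin.castSucc_lt_last k).ne']
        · intro l _ hl
          simp [hb, hl]
        · simp
  refine ⟨lam, (feasiblePWB_iff hQ hR hP Φ lam).mpr ⟨h0, hΦ, fun t w => ?_⟩, h1⟩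
  have h3 := h2 (aug t fun k => B *ᵥ w k)
  rw [hform] at h3
  simp only [Matrix.mulVec_mulVec, hB1, Matrix.one_mulVec] at h3
  refine h3.trans_eq ?_
  rw [Fintype.sum_sum_type, Fintype.sum_prod_type_right]
  congr 1
  · simp [hb, aug]
  · refine Finset.sum_congr rfl fun k _ => ?_
    rw [hB, dotProduct, Finset.mul_sum]
    exact Finset.sum_congr rfl fun j _ => by simp [hb, aug, stackDst, sq]

/-- Bound the form by `c (t² + ‖w‖²)` and choose `γ` so that the coefficient `γ - c ω` of `t²` is
`c`. -/
theorem exists_feasibleEnergy (hQ : ∀ k, (S.Q k).PosDef) (hR : ∀ k, (S.R k).PosDef) (ω : ℝ)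
    {Φ : Matrix (Stk n T ⊕ Stk m T) (Dlt n r T) ℝ} (hΦ : S.IsResponse Φ) :
    ∃ γ lam, S.FeasibleEnergy ω Φ γ lam := by
  obtain ⟨c, hc, h⟩ := exists_dotProduct_mulVec_le (S.regretForm (Φ * S.lift))
  refine ⟨c + c * ω, c, (feasibleEnergy_iff hQ hR _ _ _ _).mpr ⟨hc.le, hΦ, fun t w => ?_⟩⟩
  refine (h (aug t w)).trans_eq ?_
  rw [aug, sumElim_dotProduct_sumElim, dotProduct_stackDst]
  simp [dotProduct]
  ring

theorem exists_isGreatest_regretAt (hP : P.PosDef)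
    (Ψ : Matrix (Stk n T ⊕ Stk m T) (Unit ⊕ Dst r T) ℝ) :
    ∃ ρ, IsGreatest ((fun w => S.regretAt Ψ 1 w) '' ellipsoids T P) ρ := by
  obtain ⟨w, hw, hmax⟩ := (isCompact_ellipsoids hP).exists_isMaxOn ⟨0, zero_mem_ellipsoids⟩
    (S.continuous_regretAt_right Ψ 1).continuousOn
  exact ⟨_, ⟨w, hw, rfl⟩, by rintro _ ⟨y, hy, rfl⟩; exact hmax hy⟩

/-! ### Attainment -/

variable {ω : ℝ}

theorem exists_isLeast_bound (hQ : ∀ k, (S.Q k).PosDef) (hR : ∀ k, (S.R k).PosDef)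
    (hP : P.PosDef) (hω : ∀ w ∈ ellipsoids T P, ∑ k, w k ⬝ᵥ w k ≤ ω) :
    ∃ ρ, IsLeast {g | ∃ Φ : Matrix (Stk n T ⊕ Stk m T) (Dlt n r T) ℝ, S.IsResponse Φ ∧
      ∀ w ∈ ellipsoids T P, S.regretAt (Φ * S.lift) 1 w ≤ g} ρ := by
  obtain ⟨Φ₀, hΦ₀⟩ := S.exists_isResponse
  obtain ⟨ρ₀, hρ₀⟩ := exists_isGreatest_regretAt (S := S) hP (Φ₀ * S.lift)
  obtain ⟨B, hB, hBsub⟩ := exists_isCompact_of_regretAt_le hQ hR hω ρ₀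
  -- The epigraph of the worst-case regret over lifted responses.
  set F : Set (Matrix (Stk n T ⊕ Stk m T) (Unit ⊕ Dst r T) ℝ × ℝ) :=
    {p | p.1 ∈ S.liftedResponses ∧ ∀ w ∈ ellipsoids T P, S.regretAt p.1 1 w ≤ p.2} with hF
  have hclosed : IsClosed F := by
    refine (S.isClosed_liftedResponses.preimage continuous_fst).and ?_
    simp only [Set.ofPred_forall]
    exact isClosed_iInter fun w => isClosed_iInter fun _ =>
      isClosed_le ((S.continuous_regretAt_left 1 w).comp continuous_fst) continuous_snd
  obtain ⟨ρ, ⟨⟨Ψ, g⟩, ⟨⟨Φ, hΦ, hΦΨ⟩, hg⟩, rfl⟩, hmin⟩ :=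
    exists_isLeast_image hclosed continuous_snd (a := (Φ₀ * S.lift, ρ₀))
    ⟨⟨Φ₀, hΦ₀, rfl⟩, fun w hw => hρ₀.2 ⟨w, hw, rfl⟩⟩
    (hB.prod (isCompact_Icc (a := 0) (b := ρ₀))) fun p hp hpa => by
      obtain ⟨⟨Φ, hΦ, hΦp⟩, hp2⟩ := hp
      refine ⟨hBsub _ fun w hw => (hp2 w hw).trans hpa, ?_, hpa⟩
      refine le_trans ?_ (hp2 0 zero_mem_ellipsoids)
      rw [← hΦp]
      exact hΦ.regretAt_nonneg hQ hR 1 0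
  refine ⟨g, ⟨Φ, hΦ, fun w hw => by rw [hΦΨ]; exact hg w hw⟩, ?_⟩
  rintro g' ⟨Φ', hΦ', hg'⟩
  exact hmin ⟨(Φ' * S.lift, g'), ⟨⟨Φ', hΦ', rfl⟩, hg'⟩, rfl⟩

theorem exists_isValuePWB (hQ : ∀ k, (S.Q k).PosDef) (hR : ∀ k, (S.R k).PosDef)
    (hP : P.PosDef) (hω : ∀ w ∈ ellipsoids T P, ∑ k, w k ⬝ᵥ w k ≤ ω) :
    ∃ γ, S.IsValuePWB P γ := by
  obtain ⟨Φ₀, hΦ₀⟩ := S.exists_isResponse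
  obtain ⟨ρ₀, hρ₀⟩ := exists_isGreatest_regretAt (S := S) hP (Φ₀ * S.lift)
  obtain ⟨lam₀, hlam₀, -⟩ := hΦ₀.exists_feasiblePWB hQ hR hP (v := ρ₀)
    fun w hw => hρ₀.2 ⟨w, hw, rfl⟩
  obtain ⟨B, hB, hBsub⟩ := exists_isCompact_of_regretAt_le hQ hR hω (∑ i, lam₀ i)
  set F : Set (Matrix (Stk n T ⊕ Stk m T) (Unit ⊕ Dst r T) ℝ × (Fin (T + 1) → ℝ)) :=
    {p | p.1 ∈ S.liftedResponses ∧ (∀ i, 0 ≤ p.2 i) ∧ ∀ t w, S.regretAt p.1 t w ≤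
      p.2 (Fin.last T) * t ^ 2 + ∑ k : Fin T, p.2 k.castSucc * (w k ⬝ᵥ (P *ᵥ w k))} with hF
  have hmem : ∀ Φ lam, S.FeasiblePWB P Φ lam → (Φ * S.lift, lam) ∈ F := fun Φ lam h => by
    obtain ⟨h0, h1, h2⟩ := (feasiblePWB_iff hQ hR hP Φ lam).mp h
    exact ⟨⟨Φ, h1, rfl⟩, h0, h2⟩
  have hexists : ∀ p ∈ F, ∃ Φ, S.FeasiblePWB P Φ p.2 ∧ Φ * S.lift = p.1 := by
    rintro ⟨Ψ, lam⟩ ⟨⟨Φ, hΦ, rfl⟩, h0, h2⟩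
    exact ⟨Φ, (feasiblePWB_iff hQ hR hP Φ lam).mpr ⟨h0, hΦ, h2⟩, rfl⟩
  have hclosed : IsClosed F := by
    refine (S.isClosed_liftedResponses.preimage continuous_fst).and (IsClosed.and ?_ ?_)
    · simp only [Set.ofPred_forall]
      exact isClosed_iInter fun i => isClosed_le continuous_const
        ((continuous_apply i).comp continuous_snd)
    · simp only [Set.ofPred_forall]
      exact isClosed_iInter fun t => isClosed_iInter fun w =>
        isClosed_le ((S.continuous_regretAt_left t w).comp continuous_fst) (by fun_prop)
  obtain ⟨γ, ⟨p, hp, rfl⟩, hmin⟩ := exists_isLeast_image hclosed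
    (g := fun p => ∑ i, p.2 i) (by fun_prop) (hmem _ _ hlam₀)
    (hB.prod (isCompact_univ_pi fun _ : Fin (T + 1) =>
      isCompact_Icc (a := 0) (b := ∑ i, lam₀ i))) fun p hp hpa => by
      obtain ⟨Φ, hΦ, hΦp⟩ := hexists p hp
      refine ⟨hBsub _ fun w hw => ?_, fun i _ => ⟨hp.2.1 i, ?_⟩⟩
      · rw [← hΦp]
        exact (hΦ.regretAt_le hQ hR hP hw).trans hpa
      · exact (Finset.single_le_sum (fun i _ => hp.2.1 i) (Finset.mem_univ i)).trans hpa
  obtain ⟨Φ, hΦ, -⟩ := hexists p hp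
  refine ⟨_, ⟨Φ, p.2, hΦ, rfl⟩, ?_⟩
  rintro g ⟨Φ', lam', h', rfl⟩
  exact hmin ⟨_, hmem Φ' lam' h', rfl⟩

/-- Compactness requires a bound on `λ`, which `λ ω ≤ γ` supplies if `ω > 0`. If `ω = 0`, all
disturbances have zero energy, so `λ` has no effect and can be set to `0`, which is the value of `γ
/ 0`. -/
theorem FeasibleEnergy.exists_le_div (hQ : ∀ k, (S.Q k).PosDef) (hR : ∀ k, (S.R k).PosDef)
    (hP : P.PosDef) (hω : ∀ w ∈ ellipsoids T P, ∑ k, w k ⬝ᵥ w k ≤ ω)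
    {Φ : Matrix (Stk n T ⊕ Stk m T) (Dlt n r T) ℝ} {γ lam : ℝ}
    (h : S.FeasibleEnergy ω Φ γ lam) : ∃ lam' ≤ γ / ω, S.FeasibleEnergy ω Φ γ lam' := by
  have hω0 : 0 ≤ ω := by simpa using hω 0 zero_mem_ellipsoids
  rcases hω0.eq_or_lt with h0 | h0
  · obtain ⟨μ, hμ0, hμ, w₀, hw₀, hw₀μ⟩ := exists_dotProduct_self_le hP
    have hTμ : (T : ℝ) * μ ≤ 0 := by
      have := hω (fun _ => w₀) fun _ => hw₀
      simpa [hw₀μ, ← h0] using this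
    have hzero : ∀ w : Fin T → Fin r → ℝ, ∑ k, w k ⬝ᵥ w k = 0 := by
      intro w
      refine Finset.sum_eq_zero fun k _ => le_antisymm ?_ (zero_le_dotProduct_self _)
      have hT : (0 : ℝ) < T := by exact_mod_cast k.pos
      have hμ' : μ = 0 := le_antisymm (by nlinarith) hμ0
      simpa [hμ'] using hμ (w k)
    refine ⟨0, by simp [← h0], ?_⟩
    rw [feasibleEnergy_iff hQ hR] at h ⊢
    refine ⟨le_rfl, h.2.1, fun t w => ?_⟩
    have := h.2.2 t w
    rw [hzero, ← h0] at this
    rw [hzero, ← h0]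
    simpa using this
  · exact ⟨lam, (le_div_iff₀ h0).mpr (h.mul_le hQ hR), h⟩

theorem exists_isValueEnergy (hQ : ∀ k, (S.Q k).PosDef) (hR : ∀ k, (S.R k).PosDef)
    (hP : P.PosDef) (hω : ∀ w ∈ ellipsoids T P, ∑ k, w k ⬝ᵥ w k ≤ ω) :
    ∃ γ, S.IsValueEnergy ω γ := by
  have hω0 : 0 ≤ ω := by simpa using hω 0 zero_mem_ellipsoids
  obtain ⟨Φ₀, hΦ₀⟩ := S.exists_isResponse
  obtain ⟨γ₀, lam₀, hfeas₀⟩ := exists_feasibleEnergy hQ hR ω hΦ₀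
  obtain ⟨lam₁, hlam₁, hfeas₁⟩ := hfeas₀.exists_le_div hQ hR hP hω
  obtain ⟨B, hB, hBsub⟩ := exists_isCompact_of_regretAt_le hQ hR hω γ₀
  -- The added constraint `λ ≤ γ / ω` excludes no value of `γ`.
  set F : Set (Matrix (Stk n T ⊕ Stk m T) (Unit ⊕ Dst r T) ℝ × (ℝ × ℝ)) :=
    {p | p.1 ∈ S.liftedResponses ∧ 0 ≤ p.2.2 ∧ p.2.2 ≤ p.2.1 / ω ∧ ∀ t w, S.regretAt p.1 t w ≤
      (p.2.1 - p.2.2 * ω) * t ^ 2 + p.2.2 * ∑ k, w k ⬝ᵥ w k} with hF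
  have hmem : ∀ Φ γ lam, S.FeasibleEnergy ω Φ γ lam → lam ≤ γ / ω →
      (Φ * S.lift, (γ, lam)) ∈ F := fun Φ γ lam h hle => by
    obtain ⟨h0, h1, h2⟩ := (feasibleEnergy_iff hQ hR ω Φ γ lam).mp h
    exact ⟨⟨Φ, h1, rfl⟩, h0, hle, h2⟩
  have hexists : ∀ p ∈ F, ∃ Φ, S.FeasibleEnergy ω Φ p.2.1 p.2.2 ∧ Φ * S.lift = p.1 := by
    rintro ⟨Ψ, γ, lam⟩ ⟨⟨Φ, hΦ, rfl⟩, h0, -, h2⟩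
    exact ⟨Φ, (feasibleEnergy_iff hQ hR ω Φ γ lam).mpr ⟨h0, hΦ, h2⟩, rfl⟩
  have hclosed : IsClosed F := by
    refine (S.isClosed_liftedResponses.preimage continuous_fst).and
      ((isClosed_le (by fun_prop) (by fun_prop)).and
        ((isClosed_le (by fun_prop) (by fun_prop)).and ?_))
    simp only [Set.ofPred_forall]
    exact isClosed_iInter fun t => isClosed_iInter fun w =>
      isClosed_le ((S.continuous_regretAt_left t w).comp continuous_fst) (by fun_prop)
  obtain ⟨γ, ⟨p, hp, rfl⟩, hmin⟩ := exists_isLeast_image hclosed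
    (g := fun p => p.2.1) (by fun_prop) (hmem _ _ _ hfeas₁ hlam₁)
    (hB.prod ((isCompact_Icc (a := 0) (b := γ₀)).prod
      (isCompact_Icc (a := 0) (b := γ₀ / ω)))) fun p hp hpa => by
      obtain ⟨Φ, hΦ, hΦp⟩ := hexists p hp
      refine ⟨hBsub _ fun w hw => ?_, ⟨?_, hpa⟩, hp.2.1, hp.2.2.1.trans ?_⟩
      · rw [← hΦp]
        exact (hΦ.regretAt_le hQ hR hω hw).trans hpa
      · exact (mul_nonneg hp.2.1 hω0).trans (hΦ.mul_le hQ hR)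
      · exact div_le_div_of_nonneg_right hpa hω0
  obtain ⟨Φ, hΦ, -⟩ := hexists p hp
  refine ⟨_, ⟨Φ, p.2.2, hΦ⟩, ?_⟩
  rintro g ⟨Φ', lam', h'⟩
  obtain ⟨lam'', hle, h''⟩ := h'.exists_le_div hQ hR hP hω
  exact hmin ⟨_, hmem Φ' g lam'' h'' hle, rfl⟩

/-- The least upper bound on the regret of a response is the optimal dynamic regret. -/
theorem isOptRegret_of_isLeast (hQ : ∀ k, (S.Q k).PosDef) (hR : ∀ k, (S.R k).PosDef)
    (hE : ∃ L : Matrix (Dlt n r T) (Stk n T) ℝ, L * S.calE = 1) (hP : P.PosDef) {ρ : ℝ}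
    (hρ : IsLeast {g | ∃ Φ : Matrix (Stk n T ⊕ Stk m T) (Dlt n r T) ℝ, S.IsResponse Φ ∧
      ∀ w ∈ ellipsoids T P, S.regretAt (Φ * S.lift) 1 w ≤ g} ρ) :
    S.IsOptRegret (ellipsoids T P) ρ := by
  obtain ⟨⟨Φ, hΦ, hle⟩, hmin⟩ := hρ
  constructor
  · obtain ⟨L, hL, hK⟩ := hΦ.exists_leftInverse hE
    have hKΦ : Φ.toRows₂ * L * Φ.toRows₁ = Φ.toRows₂ := by
      rw [Matrix.mul_assoc, hL, Matrix.mul_one]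
    refine ⟨Φ.toRows₂ * L, hK, (hΦ.isWorstRegret_iff hQ hR hK hKΦ _ _).mpr ?_⟩
    obtain ⟨ρ', hρ'⟩ := exists_isGreatest_regretAt (S := S) hP (Φ * S.lift)
    have h1 : ρ' ≤ ρ := by
      obtain ⟨w, hw, rfl⟩ := hρ'.1
      exact hle w hw
    -- The true worst case is itself an admissible bound, so the least bound equals it.
    have h2 : ρ ≤ ρ' := hmin ⟨Φ, hΦ, fun w hw => hρ'.2 ⟨w, hw, rfl⟩⟩
    rwa [le_antisymm h2 h1]
  · rintro g ⟨K, hK, hg⟩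
    obtain ⟨Φ', hΦ', hKΦ'⟩ := exists_isResponse_of_causalGain (S := S) hK
    have hg' := (hΦ'.isWorstRegret_iff hQ hR hK hKΦ' _ _).mp hg
    exact hmin ⟨Φ', hΦ', fun w hw => hg'.2 ⟨w, hw, rfl⟩⟩

end Programs

end Plant

end RegretControl

end

/-! ### The bounds between the three optimal values -/

theorem theorem2 {n m r T : ℕ} (S : RegretControl.Plant n m r T)
    (hQ : ∀ k, (S.Q k).PosDef) (hR : ∀ k, (S.R k).PosDef)
    (hE : ∃ L : Matrix (RegretControl.Dlt n r T) (RegretControl.Stk n T) ℝ, L * S.calE = 1)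
    (P : Matrix (Fin r) (Fin r) ℝ) (hP : P.PosDef)
    (ω : ℝ) (hω : ∀ w ∈ RegretControl.ellipsoids T P, ∑ k, w k ⬝ᵥ w k ≤ ω) :
    -- the linear matrix inequality is affine in the optimisation variables
    (∃ f : (Matrix (RegretControl.Stk n T ⊕ RegretControl.Stk m T) (RegretControl.Dlt n r T) ℝ ×
          (Fin (T + 1) → ℝ)) →ᵃ[ℝ]
        Matrix (Unit ⊕ (RegretControl.Dst r T ⊕ (RegretControl.Stk n T ⊕ RegretControl.Stk m T)))
          (Unit ⊕ (RegretControl.Dst r T ⊕ (RegretControl.Stk n T ⊕ RegretControl.Stk m T))) ℝ,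
      ∀ Φ lam, f (Φ, lam) = S.lmiPWB P Φ lam) ∧
    -- all optimal values are attained, and satisfy the claimed bounds
    ∃ γbar γstar regret : ℝ,
      S.IsValuePWB P γbar ∧ S.IsValueEnergy ω γstar ∧
      S.IsOptRegret (RegretControl.ellipsoids T P) regret ∧
      2 / Real.pi * γbar ≤ regret ∧ regret ≤ γbar ∧ γbar ≤ γstar ∧
      -- the controller recovered from any optimal solution has worst-case regret at most `γbar`
      ∀ Φ lam, S.FeasiblePWB P Φ lam → ∑ i, lam i = γbar →
        (∃ L : Matrix (RegretControl.Dlt n r T) (RegretControl.Stk n T) ℝ,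
          L * Φ.toRows₁ = 1 ∧ RegretControl.CausalGain (Φ.toRows₂ * L)) ∧
        ∀ K, RegretControl.CausalGain K → K * Φ.toRows₁ = Φ.toRows₂ →
          ∃ ρ, S.IsWorstRegret (RegretControl.ellipsoids T P) K ρ ∧ regret ≤ ρ ∧ ρ ≤ γbar := by
  obtain ⟨γbar, hγbar⟩ := RegretControl.Plant.exists_isValuePWB (S := S) hQ hR hP hω
  obtain ⟨γstar, hγstar⟩ := RegretControl.Plant.exists_isValueEnergy (S := S) hQ hR hP hω
  obtain ⟨regret, hregret⟩ := RegretControl.Plant.exists_isLeast_bound (S := S) hQ hR hP hω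
  have hopt := RegretControl.Plant.isOptRegret_of_isLeast hQ hR hE hP hregret
  refine ⟨RegretControl.Plant.exists_affineMap_eq_lmiPWB P, γbar, γstar, regret, hγbar, hγstar,
    hopt, ?_, ?_, ?_, fun Φ lam hfeas hsum => ?_⟩
  -- Certify the regret-optimal response by multipliers, at the cost of the factor `π / 2`.
  · obtain ⟨Φ, hΦ, hle⟩ := hregret.1
    obtain ⟨lam, hlam, hsum⟩ := hΦ.exists_feasiblePWB hQ hR hP hle
    have h1 := (hγbar.2 ⟨Φ, lam, hlam, rfl⟩).trans hsum
    have h2 := mul_le_mul_of_nonneg_left h1 (show 0 ≤ 2 / Real.pi by positivity)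
    have h3 : 2 / Real.pi * (Real.pi / 2 * regret) = regret := by field_simp
    rwa [h3] at h2
  · obtain ⟨Φ, lam, hfeas, rfl⟩ := hγbar.1
    exact hregret.2 ⟨Φ, hfeas.2.1, fun w hw => hfeas.regretAt_le hQ hR hP hw⟩
  · obtain ⟨Φ, lam, hfeas⟩ := hγstar.1
    obtain ⟨lam', hfeas', hle⟩ := hfeas.exists_feasiblePWB hQ hR hP hω
    exact (hγbar.2 ⟨Φ, lam', hfeas', rfl⟩).trans hle
  · have hΦ : S.IsResponse Φ := hfeas.2.1
    refine ⟨hΦ.exists_leftInverse hE, fun K hK hKΦ => ?_⟩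
    obtain ⟨ρ, hρ⟩ := RegretControl.Plant.exists_isGreatest_regretAt (S := S) hP (Φ * S.lift)
    have hworst := (hΦ.isWorstRegret_iff hQ hR hK hKΦ _ ρ).mpr hρ
    refine ⟨ρ, hworst, hopt.2 ⟨K, hK, hworst⟩, ?_⟩
    obtain ⟨w, hw, rfl⟩ := hρ.1
    exact (hfeas.regretAt_le hQ hR hP hw).trans_eq hsum
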